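/- Consider the Gaussian many-access channel with blocklength $n$: the received vector is $\boldsymbol Y=\sum_{k=1}^{\ell_n}\boldsymbol S_k(w_k)+\boldsymbol Z\in\mathbb R^n$, where $\boldsymbol Z$ has independent standard Gaussian entries. Each of the $\ell_n$ users is, independently, silent ($w_k=0$, $\boldsymbol S_k(0)=\boldsymbol 0$) with probability $1-\alpha_n$, and sends each message $w_k\in\{1,\dots,M\}$ with probability $\alpha_n/M$. An $(M,n)$ symmetric code with power constraint $P>0$ consists of codewords $\boldsymbol s_k(w)$ with $\boldsymbol s_k(0)=\boldsymbol 0$ and $\frac1n\sum_{i=1}^n s_{ki}(w)^2\le P$, and of a deterministic decoder $\mathbb R^n\to\{0,\dots,M\}^{\ell_n}$; its average error probability is the probability that the decoded tuple is not $(w_1,\dots,w_{\ell_n})$. A sequence of message lengths $v(n)$ is asymptotically achievable if there are $(\lceil e^{v(n)}\rceil,n)$ symmetric codes with power constraint $P$ whose average error probability tends to $0$ as $n\to\infty$. Let $k_n=\alpha_n\ell_n$, let $H_2(p)=-p\log p-(1-p)\log(1-p)$ (natural logarithms), and let $$\theta_n=\frac{2\ell_nH_2(\alpha_n)}{n\log(1+k_nP)},\qquad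 B(n)=\frac{n}{2k_n}\log(1+k_nP)-\frac{H_2(\alpha_n)}{\alpha_n}.$$ Suppose that $\ell_n$ is nondecreasing, $\alpha_n\in[0,1]$ converges, $\ell_n$ and $k_n$ are unbounded, $k_n=O(n)$, $\ell_ne^{-\delta k_n}\to0$ for every $\delta>0$, and $\theta_n\to\theta<1$. Two-stage scheme with parameter $\epsilon'\in(0,\min(1,P))$ and $M$ messages per user. Let $n_0=\min(n,\lceil\epsilon'n\rceil)$ if $\theta=0$ and $n_0=\min(n,\lceil(1+\epsilon')\theta_nn\rceil)$ otherwise. Each user has one signature of length $n_0$ and $M$ message-bearing words of length $n-n_0$; its codeword for a message $w\ne0$ is the signature followed by the $w$-th message-bearing word. In the random codebook all these entries are independent $\mathcal N(0,P-\epsilon')$. From the first $n_0$ received symbols the receiver identifies a set $A$ of users that minimizes the squared distance to the sum of the signatures of its users, over all sets of at most $(1+k_n^{-1/3})k_n$ users. From the last $n-n_0$ symbols it then finds, by least squares (maximum likelihood), the messages of the users in $A$, all these messages being nonzero, and declares all other users silent. Then for every $\epsilon\in(0,1)$ the message length $(1-\epsilon)B(n)$ is asymptotically achievable, and this by the two-stage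 scheme. Precisely, there is $\epsilon_0\in(0,\min(1,P)]$ such that for every $\epsilon'\in(0,\epsilon_0)$, with $M=\lceil e^{(1-\epsilon)B(n)}\rceil$: (a) the probability, over random codebook, messages and noise, that some codeword violates the power constraint $P$ or that the two-stage decoder (however it breaks ties) outputs a tuple other than the transmitted one tends to $0$ as $n\to\infty$; (b) there are $(M,n)$ symmetric codes with power constraint $P$ that are instances of the two-stage scheme (codewords from a two-stage codebook with signature length $n_0$, together with its two-stage decoder) and whose average error probability tends to $0$ as $n\to\infty$. -/

import Mathlib

open Filter Topology MeasureTheory ProbabilityTheory Asymptotics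

noncomputable section

namespace ManyAccess

/-! ### The Gaussian many-access channel and its codes -/

/-- Law of the noise over `n` channel uses: independent standard Gaussian entries. -/
def noiseLaw (n : ℕ) : Measure (Fin n → ℝ) :=
  Measure.pi fun _ => gaussianReal 0 1

/-- Probability of the message `w` of one user: a user is silent (message `0`) with probability
`1 - α`, and sends each of the messages `1, …, M` with probability `α / M`. -/
def messageProb (α : ℝ) (M : ℕ) (w : Fin (M + 1)) : ℝ :=
  if w = 0 then 1 - α else α / M

/-- Probability of the message tuple `w` when the users' messages are independent. -/
def messageTupleProb (α : ℝ) {ℓ M : ℕ} (w : Fin ℓ → Fin (M + 1)) : ℝ :=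
  ∏ k, messageProb α M (w k)

/-- Power constraint `(1 / n) ∑ᵢ sᵢ² ≤ P` on a word of length `n`. -/
def MeetsPower (P : ℝ) {n : ℕ} (s : Fin n → ℝ) : Prop :=
  (1 / (n : ℝ)) * ∑ i, s i ^ 2 ≤ P

/-- The received block when user `k` sends the message `w k` and the noise is `z`. -/
def received {ℓ M n : ℕ} (encode : Fin ℓ → Fin (M + 1) → Fin n → ℝ)
    (w : Fin ℓ → Fin (M + 1)) (z : Fin n → ℝ) : Fin n → ℝ :=
  fun i => (∑ k, encode k (w k) i) + z i

/-- An `(M, n)` symmetric code with power constraint `P` for `ℓ` users. -/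
structure SymmetricCode (ℓ M n : ℕ) (P : ℝ) where
  encode : Fin ℓ → Fin (M + 1) → Fin n → ℝ
  encode_zero : ∀ k, encode k 0 = 0
  power : ∀ k w, MeetsPower P (encode k w)
  decode : (Fin n → ℝ) → Fin ℓ → Fin (M + 1)
  measurable_decode : Measurable decode

/-- Average error probability of a code when every user is active with probability `α`:
the probability, over the messages and the noise, that the decoded tuple is not the sent one. -/
def SymmetricCode.errorProb {ℓ M n : ℕ} {P : ℝ} (C : SymmetricCode ℓ M n P) (α : ℝ) : ℝ :=
  ∑ w : Fin ℓ → Fin (M + 1), messageTupleProb α w *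
    (noiseLaw n).real {z | C.decode (received C.encode w z) ≠ w}

/-- The number `⌈exp (v n)⌉` of messages for the message length `v n` (in nats). -/
def codeSize (v : ℕ → ℝ) (n : ℕ) : ℕ := ⌈Real.exp (v n)⌉₊

/-- There are `(⌈exp (v n)⌉, n)` codes, all in the class `Q`, whose average error probability
vanishes as `n → ∞`. -/
def IsAsymptoticallyAchievableBy (ℓ : ℕ → ℕ) (α : ℕ → ℝ) (P : ℝ) (v : ℕ → ℝ)
    (Q : ∀ n, SymmetricCode (ℓ n) (codeSize v n) n P → Prop) : Prop :=
  ∃ C : ∀ n, SymmetricCode (ℓ n) (codeSize v n) n P,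
    (∀ n, Q n (C n)) ∧ Tendsto (fun n => (C n).errorProb (α n)) atTop (𝓝 0)

/-- Asymptotically achievable message length.  The notion is usually reserved for positive
nondecreasing `v`; here it makes sense for every real sequence `v`. -/
def IsAsymptoticallyAchievable (ℓ : ℕ → ℕ) (α : ℕ → ℝ) (P : ℝ) (v : ℕ → ℝ) : Prop :=
  IsAsymptoticallyAchievableBy ℓ α P v fun _ _ => True

/-! ### The quantities `k_n`, `θ_n`, `B(n)` -/

/-- Average number of active users, `k_n = α_n ℓ_n`. -/
def avgActive (ℓ : ℕ → ℕ) (α : ℕ → ℝ) (n : ℕ) : ℝ := α n * ℓ n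

/-- The overhead factor `θ_n = 2 ℓ_n H₂(α_n) / (n log (1 + k_n P))`. -/
def overhead (ℓ : ℕ → ℕ) (α : ℕ → ℝ) (P : ℝ) (n : ℕ) : ℝ :=
  2 * ℓ n * Real.binEntropy (α n) / (n * Real.log (1 + avgActive ℓ α n * P))

/-- `B(n) = n / (2 k_n) * log (1 + k_n P) - H₂(α_n) / α_n`. -/
def msgCapacity (ℓ : ℕ → ℕ) (α : ℕ → ℝ) (P : ℝ) (n : ℕ) : ℝ :=
  n / (2 * avgActive ℓ α n) * Real.log (1 + avgActive ℓ α n * P)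
    - Real.binEntropy (α n) / α n

/-! ### The two-stage scheme -/

/-- A two-stage codebook: a signature of length `n₀` for every user, and `M` message-bearing
words of length `n₁` for every user. -/
abbrev TwoStageBook (ℓ M n₀ n₁ : ℕ) : Type :=
  (Fin ℓ → Fin n₀ → ℝ) × (Fin ℓ → Fin M → Fin n₁ → ℝ)

/-- The first `n₀` entries of a block. -/
def firstPart {n₀ n : ℕ} (h : n₀ ≤ n) (y : Fin n → ℝ) : Fin n₀ → ℝ :=
  fun i => y (Fin.castLE h i)

/-- The last `n - n₀` entries of a block. -/
def lastPart (n₀ : ℕ) {n : ℕ} (y : Fin n → ℝ) : Fin (n - n₀) → ℝ :=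
  fun j => y ⟨n₀ + j, by omega⟩

/-- The word that carries message `w` in the second stage; message `0` is the all-zero word. -/
def msgWord {M n₁ : ℕ} (words : Fin M → Fin n₁ → ℝ) (w : Fin (M + 1)) : Fin n₁ → ℝ :=
  Fin.cases 0 words w

/-- Codewords of the scheme: silence is the all-zero codeword, and the codeword of message
`m + 1` is the user's signature followed by its `m`-th message-bearing word. -/
def twoStageCodeword {ℓ M n₀ n : ℕ} (b : TwoStageBook ℓ M n₀ (n - n₀))
    (k : Fin ℓ) (w : Fin (M + 1)) : Fin n → ℝ :=
  Fin.cases 0 (fun m i => if h : (i : ℕ) < n₀ then b.1 k ⟨i, h⟩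
    else b.2 k m ⟨(i : ℕ) - n₀, by omega⟩) w

/-- `A` is a possible outcome of the user identification: it minimizes the squared distance
between the received signature block `ya` and the superposition of the signatures of the users in
`A`, among all sets of at most `K` users. -/
def IsLeastSquaresSet {ℓ n₀ : ℕ} (sig : Fin ℓ → Fin n₀ → ℝ) (K : ℝ) (ya : Fin n₀ → ℝ)
    (A : Finset (Fin ℓ)) : Prop :=
  (A.card : ℝ) ≤ K ∧ ∀ A' : Finset (Fin ℓ), (A'.card : ℝ) ≤ K →
    ∑ i, (ya i - ∑ k ∈ A, sig k i) ^ 2 ≤ ∑ i, (ya i - ∑ k ∈ A', sig k i) ^ 2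

/-- `d` is a possible outcome of the message decoding for the users in `A`: among the message
tuples in which exactly the users in `A` are active, it minimizes the squared distance between the
received block `yb` and the superposition of the message-bearing words (maximum likelihood). -/
def IsMaxLikelihood {ℓ M n₁ : ℕ} (words : Fin ℓ → Fin M → Fin n₁ → ℝ) (A : Finset (Fin ℓ))
    (yb : Fin n₁ → ℝ) (d : Fin ℓ → Fin (M + 1)) : Prop :=
  (∀ k, d k ≠ 0 ↔ k ∈ A) ∧ ∀ d' : Fin ℓ → Fin (M + 1), (∀ k, d' k ≠ 0 ↔ k ∈ A) →
    ∑ j, (yb j - ∑ k, msgWord (words k) (d k) j) ^ 2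
      ≤ ∑ j, (yb j - ∑ k, msgWord (words k) (d' k) j) ^ 2

/-- `d` is a possible output of the two-stage decoder on the received block `y`: identification
of a set of at most `K` users, then maximum-likelihood decoding of these users.  The output is
unique except for ties in the two minimizations. -/
def IsTwoStageOutput {ℓ M n₀ n : ℕ} (h : n₀ ≤ n) (b : TwoStageBook ℓ M n₀ (n - n₀)) (K : ℝ)
    (y : Fin n → ℝ) (d : Fin ℓ → Fin (M + 1)) : Prop :=
  ∃ A : Finset (Fin ℓ), IsLeastSquaresSet b.1 K (firstPart h y) A ∧
    IsMaxLikelihood b.2 A (lastPart n₀ y) d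

/-- Law of the random codebook: all entries independent Gaussian with mean zero and
variance `P'`. -/
def bookLaw (P' : NNReal) (ℓ M n₀ n₁ : ℕ) : Measure (TwoStageBook ℓ M n₀ n₁) :=
  (Measure.pi fun _ => Measure.pi fun _ => gaussianReal 0 P').prod
    (Measure.pi fun _ => Measure.pi fun _ => Measure.pi fun _ => gaussianReal 0 P')

/-- Probability, over random codebook, messages and noise, that the scheme fails: a codeword
violates the power constraint `P`, or the two-stage decoder may output (for some way to break
ties) a tuple other than the transmitted one. -/
def twoStageFailureProb {n₀ n : ℕ} (h : n₀ ≤ n) (ℓ M : ℕ) (α P : ℝ) (P' : NNReal) (K : ℝ) : ℝ :=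
  ∑ w : Fin ℓ → Fin (M + 1), messageTupleProb α w *
    ((bookLaw P' ℓ M n₀ (n - n₀)).prod (noiseLaw n)).real
      {p | (∃ k w', ¬ MeetsPower P (twoStageCodeword (n := n) p.1 k w')) ∨
        ∃ d, IsTwoStageOutput h p.1 K (received (twoStageCodeword p.1) w p.2) d ∧ d ≠ w}

/-- The weight bound `(1 + δ) k` of the identification stage, with `δ = k ^ (-1/3)`. -/
def weightBound (k : ℝ) : ℝ := (1 + k ^ (-(1 / 3) : ℝ)) * k

/-- The signature length with parameter `e`: `e n` if the limit `θ` of `θ_n` is zero, and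
`(1 + e) θ_n n` otherwise, rounded up to an integer and cut off at the blocklength. -/
def sigLength (ℓ : ℕ → ℕ) (α : ℕ → ℝ) (P θ e : ℝ) (n : ℕ) : ℕ :=
  min ⌈if θ = 0 then e * n else (1 + e) * overhead ℓ α P n * n⌉₊ n

theorem sigLength_le (ℓ : ℕ → ℕ) (α : ℕ → ℝ) (P θ e : ℝ) (n : ℕ) :
    sigLength ℓ α P θ e n ≤ n :=
  min_le_right _ _

/-- The code `C` is an instance of the two-stage scheme with signature length `n₀` and weight
bound `K`: its codewords come from a two-stage codebook, and its decoder is the two-stage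
decoder of that codebook. -/
def IsTwoStageCode {ℓ M n₀ n : ℕ} {P : ℝ} (h : n₀ ≤ n) (K : ℝ) (C : SymmetricCode ℓ M n P) :
    Prop :=
  ∃ b : TwoStageBook ℓ M n₀ (n - n₀), C.encode = twoStageCodeword b ∧
    ∀ y, IsTwoStageOutput h b K y (C.decode y)

end ManyAccess

end

/-! The proof is random coding with a union bound. In either stage a competitor wins only if `‖z +
D‖² ≤ ‖z‖²`, where `z` is the noise and `D` is the true superposition minus the competing one. Over
the random codebook `D` is a white Gaussian vector whose variance per entry is proportional to the
number `u` of users on which truth and competitor differ. Given `D` the event has probability at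
most `exp (-‖D‖² / 8)`, and averaging over `D` gives the pairwise bounds `(1 + u v / 4) ^ (-n₀ / 2)`
for identification and `(1 + u v / 2) ^ (-(n - n₀) / 2)` for messages (`prod_closer_le`).

Each union bound is split at `u = k / A`, with a constant `A` independent of `n`. For small `u`,
concavity of the logarithm makes the exponent at least linear in `u`. The pairwise probability is
then at most `ℓ ^ (-2u)`, respectively `(M k²) ^ (-u)`, and summing over all competitors is a
product expansion that tends to `1`; the term of the truth itself is the `1` to subtract.

For large `u`, `log (1 + k c / A)` agrees with `log (1 + k P)` up to a factor near `1`. In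
identification the exponent exceeds the logarithm of the number of all admissible sets, about `ℓ
H₂(α)`: this is what a signature length of at least `(1 + e) θ_n n` buys. In message decoding the
exponent is at least `u log M + 3k`, because `B(n) = (1 - θ_n) n / (2k) log (1 + k P)` and at least
`(1 - ε/2) (1 - θ_n) n` symbols remain, which leaves slack over the rate `(1 - ε) B(n)`. The two
regimes are combined in `exp_identification_le` and `exp_message_le`, and the constants are fixed in
`eventually_identification` and `eventually_message`.

Two further error sources are Chernoff bounds. More than `(1 + δ) k` users are active with
probability at most `exp (-δ² k / 4)`, where `δ = k ^ (-1/3)` gives `δ² k = k ^ (1/3) → ∞`. A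
codeword of variance `P - e` violates the power constraint with probability `exp (-n q)`, `q > 0`,
while the number of codewords grows more slowly than `exp (n q)`. Finally, some codebook does at
least as well as the average, and it meets the power constraint as soon as the average failure
probability is below `1`. -/

noncomputable section

namespace ManyAccess

open scoped ENNReal NNReal symmDiff

/-! ### Gaussian vectors -/

/-- Law of a vector of `n` independent centered Gaussian variables of variance `v`. -/
def gaussVec (v : ℝ≥0) (n : ℕ) : Measure (Fin n → ℝ) :=
  Measure.pi fun _ => gaussianReal 0 v

instance (v : ℝ≥0) (n : ℕ) : IsProbabilityMeasure (gaussVec v n) := by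
  unfold gaussVec; infer_instance

instance (n : ℕ) : IsProbabilityMeasure (noiseLaw n) := by
  unfold noiseLaw; infer_instance

theorem lintegral_pi_prod {ι : Type*} [Fintype ι] {X : ι → Type*} [∀ i, MeasurableSpace (X i)]
    (μ : ∀ i, Measure (X i)) [∀ i, IsProbabilityMeasure (μ i)] (f : ∀ i, X i → ℝ≥0∞)
    (hf : ∀ i, Measurable (f i)) :
    ∫⁻ x, ∏ i, f i (x i) ∂Measure.pi μ = ∏ i, ∫⁻ x, f i x ∂μ i := by
  refine (lintegral_prod_eq_prod_lintegral_of_indepFun Finset.univ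
    (fun i (x : ∀ i, X i) => f i (x i)) (iIndepFun_pi fun i => (hf i).aemeasurable)
    fun i => (hf i).comp (measurable_pi_apply i)).trans ?_
  refine Finset.prod_congr rfl fun i _ => ?_
  exact (measurePreserving_eval μ i).lintegral_comp (hf i)

theorem ofReal_exp_sum {ι : Type*} (s : Finset ι) (f : ι → ℝ) :
    ENNReal.ofReal (Real.exp (∑ i ∈ s, f i)) = ∏ i ∈ s, ENNReal.ofReal (Real.exp (f i)) := by
  rw [Real.exp_sum, ENNReal.ofReal_prod_of_nonneg fun i _ => (Real.exp_pos _).le]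

/-- A negative `s` is allowed as long as the integral converges: `s = 1/8` serves the pairwise error
bound, and `s < 0` the Chernoff bound for the power constraint. -/
theorem lintegral_exp_neg_mul_sq_gaussianReal (s : ℝ) (v : ℝ≥0) (h : 0 < 1 + 2 * s * v) :
    ∫⁻ x, ENNReal.ofReal (Real.exp (-s * x ^ 2)) ∂gaussianReal 0 v
      = ENNReal.ofReal (Real.exp (-(1 / 2) * Real.log (1 + 2 * s * v))) := by
  rcases eq_or_ne v 0 with rfl | hv
  · simp [gaussianReal_zero_var]
  have hv' : (0 : ℝ) < v := by positivity
  set b : ℝ := s + 1 / (2 * v) with hb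
  have hb' : b = (1 + 2 * s * v) / (2 * v) := by rw [hb]; field_simp; ring
  have hbpos : 0 < b := by rw [hb']; positivity
  have hpdf : ∀ x, gaussianPDFReal 0 v x * Real.exp (-s * x ^ 2)
      = (√(2 * Real.pi * v))⁻¹ * Real.exp (-b * x ^ 2) := by
    intro x
    rw [gaussianPDFReal, mul_assoc, ← Real.exp_add]
    congr 2
    rw [hb]; field_simp; ring
  rw [gaussianReal_of_var_ne_zero _ hv,
    lintegral_withDensity_eq_lintegral_mul _ (measurable_gaussianPDF 0 v) (by fun_prop)]
  have : ∀ x, (gaussianPDF 0 v * fun x => ENNReal.ofReal (Real.exp (-s * x ^ 2))) x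
      = ENNReal.ofReal ((√(2 * Real.pi * v))⁻¹ * Real.exp (-b * x ^ 2)) := by
    intro x
    rw [Pi.mul_apply, gaussianPDF, ← ENNReal.ofReal_mul (gaussianPDFReal_nonneg _ _ _), hpdf]
  simp_rw [this]
  rw [← ofReal_integral_eq_lintegral_ofReal ((integrable_exp_neg_mul_sq hbpos).const_mul _)
    (ae_of_all _ fun x => by positivity), integral_const_mul, integral_gaussian]
  congr 1
  rw [show -(1 / 2) * Real.log (1 + 2 * s * v) = Real.log (1 + 2 * s * v) * (-(1 / 2)) by ring,
    Real.exp_mul, Real.exp_log h, Real.rpow_neg h.le, ← Real.sqrt_eq_rpow, ← Real.sqrt_inv,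
    ← Real.sqrt_inv, ← Real.sqrt_mul (by positivity)]
  congr 1
  rw [hb']
  have := Real.pi_pos
  field_simp

theorem lintegral_exp_neg_mul_sq_gaussVec (s : ℝ) (v : ℝ≥0) (n : ℕ) (h : 0 < 1 + 2 * s * v) :
    ∫⁻ x, ENNReal.ofReal (Real.exp (-s * ∑ i, x i ^ 2)) ∂gaussVec v n
      = ENNReal.ofReal (Real.exp (-(n / 2) * Real.log (1 + 2 * s * v))) := by
  simp_rw [Finset.mul_sum, ofReal_exp_sum]
  rw [gaussVec, lintegral_pi_prod _ (fun _ x => ENNReal.ofReal (Real.exp (-s * x ^ 2)))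
    fun _ => by fun_prop]
  rw [Finset.prod_congr rfl fun i _ => lintegral_exp_neg_mul_sq_gaussianReal s v h,
    Finset.prod_const, Finset.card_univ, Fintype.card_fin,
    ← ENNReal.ofReal_pow (Real.exp_pos _).le, ← Real.exp_nat_mul]
  congr 2; ring

theorem lintegral_exp_mul_gaussianReal (t : ℝ) :
    ∫⁻ x, ENNReal.ofReal (Real.exp (t * x)) ∂gaussianReal 0 1
      = ENNReal.ofReal (Real.exp (t ^ 2 / 2)) := by
  rw [← ofReal_integral_eq_lintegral_ofReal (integrable_exp_mul_gaussianReal t)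
    (ae_of_all _ fun x => by positivity)]
  have := mgf_gaussianReal (p := gaussianReal 0 1) (X := id) (μ := 0) (v := 1) (by simp) t
  simp only [mgf, id] at this
  rw [this]
  simp

/-- A shift by `d` of white noise decreases its norm with probability at most
`exp (-‖d‖² / 8)`. -/
theorem noiseLaw_closer_le {m : ℕ} (d : Fin m → ℝ) :
    noiseLaw m {z | ∑ i, (z i + d i) ^ 2 ≤ ∑ i, z i ^ 2}
      ≤ ENNReal.ofReal (Real.exp (-(1 / 8) * ∑ i, d i ^ 2)) := by
  -- Chernoff bound with the weight `exp ((‖z‖² - ‖z + d‖²) / 4)`. A parameter `s` in place of `1/4`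
  -- gives the exponent `(-s + 2 s²) ‖d‖²`, which is smallest at `s = 1/4`.
  have hle : ∀ z : Fin m → ℝ, {z : Fin m → ℝ | ∑ i, (z i + d i) ^ 2 ≤ ∑ i, z i ^ 2}.indicator
      (1 : (Fin m → ℝ) → ℝ≥0∞) z
      ≤ ∏ i, ENNReal.ofReal (Real.exp (-(1 / 4) * d i ^ 2 + (-(1 / 2) * d i) * z i)) := by
    intro z
    rw [← ofReal_exp_sum]
    by_cases hz : z ∈ {z : Fin m → ℝ | ∑ i, (z i + d i) ^ 2 ≤ ∑ i, z i ^ 2}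
    swap
    · rw [Set.indicator_of_notMem hz]; exact zero_le
    rw [Set.indicator_of_mem hz, Pi.one_apply, ENNReal.one_le_ofReal, Real.one_le_exp_iff]
    have : ∑ i, (-(1 / 4) * d i ^ 2 + (-(1 / 2) * d i) * z i)
        = (1 / 4) * (∑ i, z i ^ 2 - ∑ i, (z i + d i) ^ 2) := by
      rw [← Finset.sum_sub_distrib, Finset.mul_sum]
      refine Finset.sum_congr rfl fun i _ => by ring
    rw [this]
    have : ∑ i, (z i + d i) ^ 2 ≤ ∑ i, z i ^ 2 := hz
    linarith
  have hmeas : MeasurableSet {z : Fin m → ℝ | ∑ i, (z i + d i) ^ 2 ≤ ∑ i, z i ^ 2} :=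
    measurableSet_le (by fun_prop) (by fun_prop)
  rw [← lintegral_indicator_one hmeas]
  refine (lintegral_mono hle).trans ?_
  rw [noiseLaw, lintegral_pi_prod _ (fun i x =>
    ENNReal.ofReal (Real.exp (-(1 / 4) * d i ^ 2 + (-(1 / 2) * d i) * x))) fun _ => by fun_prop]
  have : ∀ i, ∫⁻ x, ENNReal.ofReal (Real.exp (-(1 / 4) * d i ^ 2 + (-(1 / 2) * d i) * x))
      ∂gaussianReal 0 1 = ENNReal.ofReal (Real.exp (-(1 / 8) * d i ^ 2)) := by
    intro i
    simp_rw [Real.exp_add, ENNReal.ofReal_mul (Real.exp_pos _).le]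
    rw [lintegral_const_mul _ (by fun_prop), lintegral_exp_mul_gaussianReal,
      ← ENNReal.ofReal_mul (Real.exp_pos _).le, ← Real.exp_add]
    congr 2; ring
  simp_rw [this]
  rw [← ofReal_exp_sum, Finset.mul_sum]

theorem gaussVec_conv (v w : ℝ≥0) (n : ℕ) :
    (gaussVec v n).conv (gaussVec w n) = gaussVec (v + w) n := by
  have h1 := (measurePreserving_arrowProdEquivProdArrow ℝ ℝ (Fin n)
    (fun _ => gaussianReal 0 v) (fun _ => gaussianReal 0 w)).map_eq
  rw [Measure.conv, gaussVec, gaussVec, ← h1, Measure.map_map (by fun_prop)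
    (MeasurableEquiv.measurable _)]
  have h2 : (fun x : (Fin n → ℝ) × (Fin n → ℝ) => x.1 + x.2) ∘
      (MeasurableEquiv.arrowProdEquivProdArrow ℝ ℝ (Fin n))
      = fun (x : Fin n → ℝ × ℝ) i => (fun p : ℝ × ℝ => p.1 + p.2) (x i) := by
    ext x i; rfl
  have h3 : ((gaussianReal 0 v).prod (gaussianReal 0 w)).map (fun p : ℝ × ℝ => p.1 + p.2)
      = gaussianReal 0 (v + w) := by
    have := gaussianReal_conv_gaussianReal (m₁ := 0) (m₂ := 0) (v₁ := v) (v₂ := w)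
    rwa [add_zero, Measure.conv] at this
  have : SigmaFinite (((gaussianReal 0 v).prod (gaussianReal 0 w)).map
      (fun p : ℝ × ℝ => p.1 + p.2)) := by rw [h3]; infer_instance
  rw [h2, Measure.pi_map_pi (f := fun _ (p : ℝ × ℝ) => p.1 + p.2) fun _ => by fun_prop]
  simp_rw [h3]
  rfl

theorem gaussVec_zero (n : ℕ) : gaussVec 0 n = Measure.dirac 0 := by
  simp only [gaussVec, gaussianReal_zero_var]
  refine (Measure.pi_eq fun s hs => ?_)
  rw [Measure.dirac_apply' _ (MeasurableSet.univ_pi hs)]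
  simp_rw [Measure.dirac_apply' _ (hs _)]
  by_cases h : (0 : Fin n → ℝ) ∈ Set.univ.pi s
  · rw [Set.indicator_of_mem h, Finset.prod_eq_one]
    · rfl
    · intro i _
      exact Set.indicator_of_mem (h i trivial) _
  · rw [Set.indicator_of_notMem h]
    obtain ⟨i, hi⟩ : ∃ i, (0 : ℝ) ∉ s i := by
      by_contra hc
      push Not at hc
      exact h fun i _ => hc i
    rw [Finset.prod_eq_zero (Finset.mem_univ i) (Set.indicator_of_notMem hi _)]

/-- The law of a sum of independent Gaussian vectors, each a function of its own coordinate of a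
product space. -/
theorem map_sum_gaussVec {ι : Type*} [Fintype ι] {X : ι → Type*} [∀ i, MeasurableSpace (X i)]
    (μ : ∀ i, Measure (X i)) [∀ i, IsProbabilityMeasure (μ i)] {n : ℕ}
    (f : ∀ i, X i → Fin n → ℝ) (hf : ∀ i, Measurable (f i)) (v : ι → ℝ≥0)
    (hv : ∀ i, (μ i).map (f i) = gaussVec (v i) n) :
    (Measure.pi μ).map (fun x => ∑ i, f i (x i)) = gaussVec (∑ i, v i) n := by
  have hind : iIndepFun (fun i x => f i (x i)) (Measure.pi μ) :=
    iIndepFun_pi fun i => (hf i).aemeasurable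
  have hmeas : ∀ i, Measurable fun x : ∀ i, X i => f i (x i) :=
    fun i => (hf i).comp (measurable_pi_apply i)
  have hmap : ∀ i, (Measure.pi μ).map (fun x => f i (x i)) = gaussVec (v i) n := by
    intro i
    rw [← hv i, ← (measurePreserving_eval μ i).map_eq, Measure.map_map (hf i)
      (measurable_pi_apply i)]
    rfl
  have key : ∀ s : Finset ι, (Measure.pi μ).map (∑ i ∈ s, fun x => f i (x i))
      = gaussVec (∑ i ∈ s, v i) n := by
    intro s
    induction s using Finset.cons_induction with
    | empty =>
      rw [Finset.sum_empty, Finset.sum_empty, gaussVec_zero]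
      exact (Measure.map_const _ _).trans (by simp; rfl)
    | cons i s hi ih =>
      rw [Finset.sum_cons, Finset.sum_cons, ← gaussVec_conv, ← hmap i, ← ih]
      exact ((hind.indepFun_finsetSum_of_notMem hmeas hi).symm).map_add_eq_map_conv_map
        (hmeas i) (by
          convert Finset.measurable_sum s fun i _ => hmeas i using 1; ext x; simp)
  have := key Finset.univ
  rw [← this]
  congr 1
  ext x j
  simp

theorem map_const_smul_gaussVec (c : ℝ) (v : ℝ≥0) (n : ℕ) :
    (gaussVec v n).map (fun x => c • x) = gaussVec ((c ^ 2).toNNReal * v) n := by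
  have h : (gaussianReal 0 v).map (fun x => c * x)
      = gaussianReal 0 ((c ^ 2).toNNReal * v) := by
    rw [gaussianReal_map_const_mul, mul_zero]
    congr
    exact (max_eq_left (sq_nonneg c)).symm
  have : SigmaFinite ((gaussianReal 0 v).map (fun x => c * x)) := by rw [h]; infer_instance
  have := Measure.pi_map_pi (μ := fun _ : Fin n => gaussianReal 0 v)
    (f := fun _ x => c * x) fun _ => by fun_prop
  simp_rw [h] at this
  exact this

/-- Restricting a product of copies of one law to a subset of the coordinates. -/
theorem measurePreserving_comp_injective {ι κ : Type*} [Fintype ι] [Fintype κ] {E : Type*}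
    [MeasurableSpace E] (μ : Measure E) [IsProbabilityMeasure μ] {f : κ → ι}
    (hf : Function.Injective f) :
    MeasurePreserving (fun z : ι → E => z ∘ f) (Measure.pi fun _ => μ)
      (Measure.pi fun _ => μ) := by
  classical
  have hmeas : Measurable (fun z : ι → E => z ∘ f) :=
    measurable_pi_lambda _ fun j => measurable_pi_apply (f j)
  refine ⟨hmeas, (Measure.pi_eq fun s hs => ?_).symm⟩
  rw [Measure.map_apply hmeas (MeasurableSet.univ_pi hs)]
  -- The preimage of a box is a box that leaves the coordinates outside the range of `f` free, so
  -- these contribute a factor `1`.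
  have : (fun z : ι → E => z ∘ f) ⁻¹' (Set.univ.pi s)
      = Set.univ.pi fun i => ⋂ j ∈ {j | f j = i}, s j := by
    ext z
    simp only [Set.mem_preimage, Set.mem_pi, Set.mem_univ, true_implies, Set.mem_iInter,
      Set.mem_ofPred_eq, Function.comp]
    exact ⟨fun h i j hj => hj ▸ h j, fun h j => h _ j rfl⟩
  rw [this, Measure.pi_pi, ← Finset.prod_subset (Finset.subset_univ (Finset.univ.image f)),
    Finset.prod_image fun a _ b _ h => hf h]
  · refine Finset.prod_congr rfl fun j _ => ?_
    congr 1
    ext x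
    simp only [Set.mem_iInter, Set.mem_ofPred_eq]
    exact ⟨fun h => h j rfl, fun h j' hj => hf hj ▸ h⟩
  · intro i _ hi
    have : (⋂ j ∈ {j | f j = i}, s j) = Set.univ := by
      ext x
      simp only [Set.mem_iInter, Set.mem_univ, iff_true]
      exact fun j hj => absurd (Finset.mem_image.2 ⟨j, Finset.mem_univ _, hj⟩) hi
    rw [this, measure_univ]

theorem measurePreserving_firstPart {n₀ n : ℕ} (h : n₀ ≤ n) :
    MeasurePreserving (firstPart h) (noiseLaw n) (noiseLaw n₀) :=
  measurePreserving_comp_injective _ (Fin.castLE_injective h)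

theorem measurePreserving_lastPart (n₀ n : ℕ) :
    MeasurePreserving (lastPart n₀) (noiseLaw n) (noiseLaw (n - n₀)) :=
  measurePreserving_comp_injective (f := fun j : Fin (n - n₀) => (⟨n₀ + j, by omega⟩ : Fin n)) _
    fun a b h => by simpa [Fin.ext_iff] using h

/-- Pairwise error probability: an independent Gaussian difference signal of variance `v` per
entry makes the noise shorter with probability at most `(1 + v / 4) ^ (-m / 2)`. -/
theorem prod_closer_le {Ω : Type*} [MeasurableSpace Ω] (μ : Measure Ω) [IsProbabilityMeasure μ]
    {n m : ℕ} {D : Ω → Fin m → ℝ} (hD : Measurable D) {v : ℝ≥0} (hv : μ.map D = gaussVec v m)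
    {r : (Fin n → ℝ) → Fin m → ℝ} (hr : MeasurePreserving r (noiseLaw n) (noiseLaw m)) :
    (μ.prod (noiseLaw n)) {p | ∑ i, (r p.2 i + D p.1 i) ^ 2 ≤ ∑ i, r p.2 i ^ 2}
      ≤ ENNReal.ofReal (Real.exp (-(m / 2) * Real.log (1 + v / 4))) := by
  have hD' : ∀ i, Measurable fun x => D x i := fun i => (measurable_pi_apply i).comp hD
  have hr' : ∀ i, Measurable fun x => r x i := fun i => (measurable_pi_apply i).comp hr.measurable
  have hmeas : MeasurableSet {p : Ω × (Fin n → ℝ) |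
      ∑ i, (r p.2 i + D p.1 i) ^ 2 ≤ ∑ i, r p.2 i ^ 2} := by
    have h1 : ∀ i, Measurable fun p : Ω × (Fin n → ℝ) => D p.1 i :=
      fun i => (hD' i).comp measurable_fst
    have h2 : ∀ i, Measurable fun p : Ω × (Fin n → ℝ) => r p.2 i :=
      fun i => (hr' i).comp measurable_snd
    exact measurableSet_le (by fun_prop) (by fun_prop)
  rw [Measure.prod_apply hmeas]
  have hsec : ∀ x, noiseLaw n (Prod.mk x ⁻¹' {p : Ω × (Fin n → ℝ) |
      ∑ i, (r p.2 i + D p.1 i) ^ 2 ≤ ∑ i, r p.2 i ^ 2})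
      ≤ ENNReal.ofReal (Real.exp (-(1 / 8) * ∑ i, D x i ^ 2)) := by
    intro x
    refine le_trans (le_of_eq ?_) (noiseLaw_closer_le (D x))
    exact hr.measure_preimage (s := {z | ∑ i, (z i + D x i) ^ 2 ≤ ∑ i, z i ^ 2})
      (measurableSet_le (by fun_prop) (by fun_prop)).nullMeasurableSet
  -- Averaging over `D` is the Gaussian integral with `s = 1/8`, whence `1 + 2 s v = 1 + v / 4`.
  refine (lintegral_mono hsec).trans ?_
  have := lintegral_map (μ := μ) (g := D)
    (f := fun d : Fin m → ℝ => ENNReal.ofReal (Real.exp (-(1 / 8) * ∑ i, d i ^ 2)))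
    (by fun_prop) hD
  rw [← this, hv, lintegral_exp_neg_mul_sq_gaussVec _ _ _ (by positivity)]
  refine le_of_eq ?_
  congr 4
  ring

/-! ### Probability that the scheme fails for a fixed message tuple -/

/-- The set of users who are active in the message tuple `w`. -/
def activeSet {ℓ M : ℕ} (w : Fin ℓ → Fin (M + 1)) : Finset (Fin ℓ) :=
  Finset.univ.filter fun k => w k ≠ 0

theorem mem_activeSet {ℓ M : ℕ} {w : Fin ℓ → Fin (M + 1)} {k : Fin ℓ} :
    k ∈ activeSet w ↔ w k ≠ 0 := by
  simp [activeSet]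

/-- The number of users on whose messages `w` and `d` differ. -/
def diffCount {ℓ M : ℕ} (w d : Fin ℓ → Fin (M + 1)) : ℕ :=
  (Finset.univ.filter fun k => w k ≠ d k).card

instance (v : ℝ≥0) (ℓ M n₀ n₁ : ℕ) : IsProbabilityMeasure (bookLaw v ℓ M n₀ n₁) := by
  unfold bookLaw; infer_instance

theorem map_bookLaw_fst (v : ℝ≥0) (ℓ M n₀ n₁ : ℕ) :
    (bookLaw v ℓ M n₀ n₁).map Prod.fst = Measure.pi fun _ => gaussVec v n₀ := by
  simp [bookLaw, Measure.map_fst_prod, gaussVec]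

theorem map_bookLaw_snd (v : ℝ≥0) (ℓ M n₀ n₁ : ℕ) :
    (bookLaw v ℓ M n₀ n₁).map Prod.snd
      = Measure.pi fun _ => Measure.pi fun _ => gaussVec v n₁ := by
  simp [bookLaw, Measure.map_snd_prod, gaussVec]

/-- The law of the difference of the superpositions of the signatures of two sets of users. -/
theorem map_sigDiff (v : ℝ≥0) (ℓ M n₀ n₁ : ℕ) (A A' : Finset (Fin ℓ)) :
    (bookLaw v ℓ M n₀ n₁).map (fun b i => ∑ k ∈ A, b.1 k i - ∑ k ∈ A', b.1 k i)
      = gaussVec ((A ∆ A').card * v) n₀ := by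
  -- Signatures of common users cancel; the coefficient is `±1` on the symmetric difference and `0`
  -- elsewhere.
  set c : Fin ℓ → ℝ := fun k => (if k ∈ A then 1 else 0) - (if k ∈ A' then 1 else 0) with hc
  have hfun : (fun (b : TwoStageBook ℓ M n₀ n₁) i => ∑ k ∈ A, b.1 k i - ∑ k ∈ A', b.1 k i)
      = (fun x : Fin ℓ → Fin n₀ → ℝ => ∑ k, c k • x k) ∘ Prod.fst := by
    ext b i
    simp only [Function.comp, Finset.sum_apply, Pi.smul_apply, smul_eq_mul, hc, sub_mul,
      Finset.sum_sub_distrib, ite_mul, one_mul, zero_mul, Finset.sum_ite_mem, Finset.univ_inter]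
  rw [hfun, ← Measure.map_map (by fun_prop) measurable_fst, map_bookLaw_fst,
    map_sum_gaussVec _ (fun k x => c k • x) (fun k => by fun_prop) _
      fun k => map_const_smul_gaussVec (c k) v n₀]
  congr 1
  rw [← Finset.sum_mul]
  congr 1
  rw [Finset.card_eq_sum_ones, Nat.cast_sum, ← Finset.sum_filter_add_sum_filter_not Finset.univ
    (fun k => k ∈ A ∆ A')]
  rw [Finset.sum_eq_zero (s := Finset.univ.filter fun k => ¬ k ∈ A ∆ A'), add_zero]
  · refine Finset.sum_congr (by ext; simp) fun k hk => ?_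
    have hk : k ∈ A ∆ A' := by simpa using hk
    rcases Finset.mem_symmDiff.1 hk with h | h <;> simp [hc, h.1, h.2]
  · intro k hk
    have hk : k ∉ A ∆ A' := by simpa using hk
    rw [Finset.mem_symmDiff] at hk
    by_cases h : k ∈ A <;> by_cases h' : k ∈ A' <;> simp_all

theorem prod_identification_le (v : ℝ≥0) (ℓ M : ℕ) {n₀ n : ℕ} (h : n₀ ≤ n)
    (A A' : Finset (Fin ℓ)) :
    ((bookLaw v ℓ M n₀ (n - n₀)).prod (noiseLaw n)).real
      {p | ∑ i, (firstPart h p.2 i + (∑ k ∈ A, p.1.1 k i - ∑ k ∈ A', p.1.1 k i)) ^ 2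
        ≤ ∑ i, firstPart h p.2 i ^ 2}
      ≤ Real.exp (-(n₀ / 2) * Real.log (1 + (A ∆ A').card * v / 4)) := by
  refine ENNReal.toReal_le_of_le_ofReal (Real.exp_pos _).le ?_
  have hmeas : Measurable fun (b : TwoStageBook ℓ M n₀ (n - n₀)) i =>
      ∑ k ∈ A, b.1 k i - ∑ k ∈ A', b.1 k i := by fun_prop
  refine (prod_closer_le (bookLaw v ℓ M n₀ (n - n₀)) hmeas (map_sigDiff v ℓ M n₀ _ A A')
    (measurePreserving_firstPart h)).trans (le_of_eq ?_)
  simp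

theorem msgWord_zero {M n₁ : ℕ} (words : Fin M → Fin n₁ → ℝ) : msgWord words 0 = 0 := rfl

theorem msgWord_succ {M n₁ : ℕ} (words : Fin M → Fin n₁ → ℝ) (m : Fin M) :
    msgWord words m.succ = words m := rfl

theorem measurable_msgWord {M n₁ : ℕ} (w : Fin (M + 1)) :
    Measurable fun words : Fin M → Fin n₁ → ℝ => msgWord words w := by
  induction w using Fin.cases with
  | zero => exact measurable_const
  | succ m => exact measurable_pi_apply m

/-- Two distinct words of one user are independent, so their difference has twice the variance.
Since both messages are zero or both nonzero, the all-zero word is never compared with a Gaussian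
one. -/
theorem map_msgWord_sub (v : ℝ≥0) {M n₁ : ℕ} {w d : Fin (M + 1)} (hwd : w ≠ 0 ↔ d ≠ 0) :
    (Measure.pi fun _ : Fin M => gaussVec v n₁).map (fun x => msgWord x w - msgWord x d)
      = gaussVec (if w ≠ d then 2 * v else 0) n₁ := by
  by_cases h : w = d
  · subst h
    simp only [sub_self, ne_eq, not_true_eq_false, if_false, gaussVec_zero]
    exact (Measure.map_const _ _).trans (by simp)
  rw [if_pos h]
  have hw : w ≠ 0 := fun h0 => h (h0.trans (not_not.1 fun hd => hwd.2 (Ne.symm hd) h0))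
  obtain ⟨m, rfl⟩ := Fin.exists_succ_eq.2 hw
  obtain ⟨m', rfl⟩ := Fin.exists_succ_eq.2 (hwd.1 hw)
  have hm : m ≠ m' := fun e => h (by rw [e])
  set c : Fin M → ℝ := fun j => (if j = m then 1 else 0) - (if j = m' then 1 else 0) with hc
  have hfun : (fun x : Fin M → Fin n₁ → ℝ => msgWord x m.succ - msgWord x m'.succ)
      = fun x => ∑ j, c j • x j := by
    ext x i
    simp [msgWord_succ, hc, sub_mul, Finset.sum_sub_distrib]
  rw [hfun, map_sum_gaussVec _ (fun k x => c k • x) (fun k => by fun_prop) _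
      fun k => map_const_smul_gaussVec (c k) v n₁]
  congr 1
  rw [← Finset.sum_mul]
  congr 1
  have : ∀ j, (c j ^ 2).toNNReal = (if j = m then 1 else 0) + (if j = m' then 1 else 0) := by
    intro j
    by_cases h1 : j = m
    · have : j ≠ m' := fun h2 => hm (h1.symm.trans h2)
      simp [hc, h1, hm]
    · by_cases h2 : j = m' <;> simp [hc, h1, h2, hm.symm]
  simp_rw [this]
  rw [Finset.sum_add_distrib]
  simp
  norm_num

theorem prod_message_le (v : ℝ≥0) (ℓ M : ℕ) (n₀ n : ℕ) {w d : Fin ℓ → Fin (M + 1)}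
    (hwd : ∀ k, w k ≠ 0 ↔ d k ≠ 0) :
    ((bookLaw v ℓ M n₀ (n - n₀)).prod (noiseLaw n)).real
      {p | ∑ j, (lastPart n₀ p.2 j
          + (∑ k, (msgWord (p.1.2 k) (w k) - msgWord (p.1.2 k) (d k))) j) ^ 2
        ≤ ∑ j, lastPart n₀ p.2 j ^ 2}
      ≤ Real.exp (-((n - n₀ : ℕ) / 2) * Real.log (1 + diffCount w d * v / 2)) := by
  refine ENNReal.toReal_le_of_le_ofReal (Real.exp_pos _).le ?_
  have hmeas : ∀ k, Measurable fun x : Fin M → Fin (n - n₀) → ℝ =>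
      msgWord x (w k) - msgWord x (d k) :=
    fun k => (measurable_msgWord _).sub (measurable_msgWord _)
  have hmeas' : Measurable fun x : Fin ℓ → Fin M → Fin (n - n₀) → ℝ =>
      ∑ k, (msgWord (x k) (w k) - msgWord (x k) (d k)) :=
    Finset.measurable_sum _ fun k _ => (hmeas k).comp (measurable_pi_apply k)
  have hlaw : (bookLaw v ℓ M n₀ (n - n₀)).map
      (fun b => ∑ k, (msgWord (b.2 k) (w k) - msgWord (b.2 k) (d k)))
      = gaussVec (diffCount w d * (2 * v)) (n - n₀) := by
    have := Measure.map_map (μ := bookLaw v ℓ M n₀ (n - n₀)) hmeas' measurable_snd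
    rw [map_bookLaw_snd, map_sum_gaussVec _ (fun k x => msgWord x (w k) - msgWord x (d k)) hmeas _
      fun k => map_msgWord_sub v (hwd k)] at this
    refine this.symm.trans ?_
    congr 1
    rw [diffCount, ← Finset.sum_filter, Finset.sum_const, nsmul_eq_mul]
  refine (prod_closer_le (bookLaw v ℓ M n₀ (n - n₀)) (hmeas'.comp measurable_snd) hlaw
    (measurePreserving_lastPart n₀ n)).trans (le_of_eq ?_)
  congr 5
  push_cast
  ring

/-! #### Codewords and received blocks -/

theorem twoStageCodeword_first {ℓ M n₀ n : ℕ} (b : TwoStageBook ℓ M n₀ (n - n₀)) (k : Fin ℓ)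
    (w : Fin (M + 1)) (i : Fin n) (hi : (i : ℕ) < n₀) :
    twoStageCodeword b k w i = if w ≠ 0 then b.1 k ⟨i, hi⟩ else 0 := by
  induction w using Fin.cases with
  | zero => simp [twoStageCodeword]
  | succ m => simp [twoStageCodeword, hi, Fin.succ_ne_zero]

theorem twoStageCodeword_last {ℓ M n₀ n : ℕ} (b : TwoStageBook ℓ M n₀ (n - n₀)) (k : Fin ℓ)
    (w : Fin (M + 1)) (j : Fin (n - n₀)) :
    twoStageCodeword b k w (⟨n₀ + j, by omega⟩ : Fin n) = msgWord (b.2 k) w j := by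
  induction w using Fin.cases with
  | zero => simp [twoStageCodeword, msgWord_zero]
  | succ m => simp [twoStageCodeword, msgWord_succ]

theorem firstPart_received {ℓ M n₀ n : ℕ} (h : n₀ ≤ n) (b : TwoStageBook ℓ M n₀ (n - n₀))
    (w : Fin ℓ → Fin (M + 1)) (z : Fin n → ℝ) (i : Fin n₀) :
    firstPart h (received (twoStageCodeword b) w z) i
      = ∑ k ∈ activeSet w, b.1 k i + firstPart h z i := by
  rw [firstPart, received]
  congr 1
  rw [activeSet, Finset.sum_filter]
  exact Finset.sum_congr rfl fun k _ => twoStageCodeword_first b k (w k) _ i.2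

theorem lastPart_received {ℓ M n₀ n : ℕ} (b : TwoStageBook ℓ M n₀ (n - n₀))
    (w : Fin ℓ → Fin (M + 1)) (z : Fin n → ℝ) (j : Fin (n - n₀)) :
    lastPart n₀ (received (twoStageCodeword b) w z) j
      = ∑ k, msgWord (b.2 k) (w k) j + lastPart n₀ z j := by
  rw [lastPart, received]
  congr 1
  exact Finset.sum_congr rfl fun k _ => twoStageCodeword_last b k (w k) j

theorem sum_sq_twoStageCodeword_succ {ℓ M n₀ n : ℕ} (h : n₀ ≤ n)
    (b : TwoStageBook ℓ M n₀ (n - n₀)) (k : Fin ℓ) (m : Fin M) :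
    ∑ i, twoStageCodeword (n := n) b k m.succ i ^ 2 = ∑ i, b.1 k i ^ 2 + ∑ j, b.2 k m j ^ 2 := by
  have hn : n₀ + (n - n₀) = n := by omega
  rw [← (finCongr hn).sum_comp, Fin.sum_univ_add]
  congr 1
  · refine Finset.sum_congr rfl fun i _ => ?_
    rw [twoStageCodeword_first b k _ _ (by simp)]
    simp [Fin.succ_ne_zero]
  · refine Finset.sum_congr rfl fun j _ => ?_
    exact congrArg (· ^ 2) (twoStageCodeword_last b k m.succ j)

/-- Exponent of the probability that a Gaussian word of variance `v` violates the power
constraint `P`. -/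
def powerExponent (P v : ℝ) : ℝ := (P / v - 1 - Real.log (P / v)) / 2

theorem powerExponent_pos {P v : ℝ} (hv : 0 < v) (hvP : v < P) : 0 < powerExponent P v := by
  have h1 : 1 < P / v := (one_lt_div hv).2 hvP
  have := Real.log_lt_sub_one_of_pos (by linarith) h1.ne'
  unfold powerExponent
  linarith

theorem bookLaw_not_meetsPower_le {P : ℝ} {v : ℝ≥0} (hv : 0 < v) (hvP : v < P) (ℓ M : ℕ)
    {n₀ n : ℕ} (h : n₀ ≤ n) (k : Fin ℓ) (w : Fin (M + 1)) :
    (bookLaw v ℓ M n₀ (n - n₀)) {b | ¬ MeetsPower P (twoStageCodeword (n := n) b k w)}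
      ≤ ENNReal.ofReal (Real.exp (-(n * powerExponent P v))) := by
  have hv' : (0 : ℝ) < v := hv
  have hP : 0 < P := hv'.trans hvP
  induction w using Fin.cases with
  | zero =>
    have : {b : TwoStageBook ℓ M n₀ (n - n₀) |
        ¬ MeetsPower P (twoStageCodeword (n := n) b k 0)} = ∅ := by
      ext b
      simp [MeetsPower, twoStageCodeword, hP.le]
    rw [this, measure_empty]
    exact zero_le
  | succ m =>
    -- The optimal Chernoff parameter, for which `1 - 2 t v = v / P`.
    set t : ℝ := (P - v) / (2 * P * v) with ht
    have ht0 : 0 < t := by rw [ht]; have := sub_pos.2 hvP; positivity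
    have htv : 1 + 2 * (-t) * v = v / P := by rw [ht]; field_simp; ring
    have hpos : 0 < 1 + 2 * (-t) * v := by rw [htv]; positivity
    set F : (Fin ℓ → Fin n₀ → ℝ) → ℝ≥0∞ :=
      fun x => ENNReal.ofReal (Real.exp (-(-t) * ∑ i, x k i ^ 2)) with hF
    set G : (Fin ℓ → Fin M → Fin (n - n₀) → ℝ) → ℝ≥0∞ :=
      fun x => ENNReal.ofReal (Real.exp (-(-t) * ∑ i, x k m i ^ 2)) with hG
    have hFm : Measurable F := by fun_prop
    have hGm : Measurable G := by fun_prop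
    have hle : {b : TwoStageBook ℓ M n₀ (n - n₀) |
        ¬ MeetsPower P (twoStageCodeword (n := n) b k m.succ)}
        ⊆ {b | ENNReal.ofReal (Real.exp (t * n * P)) ≤ F b.1 * G b.2} := by
      intro b hb
      simp only [Set.mem_ofPred_eq, MeetsPower, not_le] at hb
      rw [sum_sq_twoStageCodeword_succ h] at hb
      have hn : 0 < (n : ℝ) := by
        rcases Nat.eq_zero_or_pos n with h0 | h0
        · have hn0 : (n : ℝ) = 0 := by exact_mod_cast h0
          rw [hn0, div_zero, zero_mul] at hb
          linarith
        · exact_mod_cast h0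
      rw [one_div, lt_inv_mul_iff₀ hn] at hb
      simp only [Set.mem_ofPred_eq, hF, hG]
      rw [← ENNReal.ofReal_mul (Real.exp_pos _).le, ← Real.exp_add]
      refine ENNReal.ofReal_le_ofReal (Real.exp_le_exp.2 ?_)
      have := mul_le_mul_of_nonneg_left hb.le ht0.le
      linarith
    have hI : ∫⁻ b, F b.1 * G b.2 ∂bookLaw v ℓ M n₀ (n - n₀)
        = ENNReal.ofReal (Real.exp (-(n / 2) * Real.log (v / P))) := by
      rw [bookLaw, lintegral_prod_mul hFm.aemeasurable hGm.aemeasurable]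
      have h1 : ∫⁻ x, F x ∂(Measure.pi fun _ => Measure.pi fun _ => gaussianReal 0 v)
          = ENNReal.ofReal (Real.exp (-(n₀ / 2) * Real.log (v / P))) := by
        rw [← htv, ← lintegral_exp_neg_mul_sq_gaussVec _ _ _ hpos]
        exact (measurePreserving_eval (fun _ : Fin ℓ => gaussVec v n₀) k).lintegral_comp
          (f := fun x => ENNReal.ofReal (Real.exp (-(-t) * ∑ i, x i ^ 2))) (by fun_prop)
      have h2 : ∫⁻ x, G x ∂(Measure.pi fun _ => Measure.pi fun _ => Measure.pi
            fun _ => gaussianReal 0 v)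
          = ENNReal.ofReal (Real.exp (-((n - n₀ : ℕ) / 2) * Real.log (v / P))) := by
        rw [← htv, ← lintegral_exp_neg_mul_sq_gaussVec _ _ _ hpos]
        exact (((measurePreserving_eval (fun _ : Fin M => gaussVec v (n - n₀)) m)).comp
          (measurePreserving_eval (fun _ : Fin ℓ => Measure.pi fun _ : Fin M =>
            gaussVec v (n - n₀)) k)).lintegral_comp
          (f := fun x => ENNReal.ofReal (Real.exp (-(-t) * ∑ i, x i ^ 2))) (by fun_prop)
      rw [h1, h2, ← ENNReal.ofReal_mul (Real.exp_pos _).le, ← Real.exp_add]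
      congr 2
      rw [Nat.cast_sub h]
      ring
    refine (measure_mono hle).trans ?_
    refine (meas_ge_le_lintegral_div (by fun_prop) (by simp [Real.exp_pos])
      ENNReal.ofReal_ne_top).trans ?_
    rw [hI, ← ENNReal.ofReal_div_of_pos (Real.exp_pos _), ← Real.exp_sub]
    refine le_of_eq ?_
    congr 2
    rw [powerExponent, ← inv_div P (v : ℝ), Real.log_inv, ht]
    field_simp
    ring

/-- The event that the two-stage scheme may fail when the tuple `w` is sent. -/
def failureSet {n₀ n : ℕ} (h : n₀ ≤ n) {ℓ M : ℕ} (P K : ℝ) (w : Fin ℓ → Fin (M + 1)) :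
    Set (TwoStageBook ℓ M n₀ (n - n₀) × (Fin n → ℝ)) :=
  {p | (∃ k w', ¬ MeetsPower P (twoStageCodeword (n := n) p.1 k w')) ∨
    ∃ d, IsTwoStageOutput h p.1 K (received (twoStageCodeword p.1) w p.2) d ∧ d ≠ w}

/-- If no competing set of users, no competing message tuple and no codeword is bad, then the
two-stage scheme does not fail. -/
theorem failureSet_subset {n₀ n : ℕ} (h : n₀ ≤ n) {ℓ M : ℕ} (P K : ℝ)
    (w : Fin ℓ → Fin (M + 1)) (hw : ((activeSet w).card : ℝ) ≤ K) :
    failureSet h P K w ⊆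
      (⋃ kw ∈ (Finset.univ : Finset (Fin ℓ × Fin (M + 1))),
        {b : TwoStageBook ℓ M n₀ (n - n₀) |
          ¬ MeetsPower P (twoStageCodeword (n := n) b kw.1 kw.2)} ×ˢ Set.univ) ∪
      (⋃ A ∈ Finset.univ.filter fun A : Finset (Fin ℓ) =>
          (A.card : ℝ) ≤ K ∧ A ≠ activeSet w,
        {p | ∑ i, (firstPart h p.2 i
            + (∑ k ∈ activeSet w, p.1.1 k i - ∑ k ∈ A, p.1.1 k i)) ^ 2
          ≤ ∑ i, firstPart h p.2 i ^ 2}) ∪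
      (⋃ d ∈ Finset.univ.filter fun d : Fin ℓ → Fin (M + 1) =>
          (∀ k, w k ≠ 0 ↔ d k ≠ 0) ∧ d ≠ w,
        {p | ∑ j, (lastPart n₀ p.2 j
            + (∑ k, (msgWord (p.1.2 k) (w k) - msgWord (p.1.2 k) (d k))) j) ^ 2
          ≤ ∑ j, lastPart n₀ p.2 j ^ 2}) := by
  rintro p (⟨k, w', hkw⟩ | ⟨d, ⟨A, ⟨hAK, hA⟩, hd, hdmin⟩, hdw⟩)
  · exact Or.inl (Or.inl (Set.mem_biUnion (Finset.mem_univ (k, w')) ⟨hkw, trivial⟩))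
  by_cases hAw : A = activeSet w
  · refine Or.inr (Set.mem_biUnion (x := d) ?_ ?_)
    · have : ∀ k, w k ≠ 0 ↔ d k ≠ 0 := fun k => by rw [hd k, hAw, mem_activeSet]
      exact Finset.mem_coe.2 (Finset.mem_filter.2 ⟨Finset.mem_univ _, this, hdw⟩)
    · have := hdmin w fun k => by rw [hAw, mem_activeSet]
      simp only [lastPart_received] at this
      refine le_trans (le_of_eq (Finset.sum_congr rfl fun j _ => ?_)) (this.trans (le_of_eq
        (Finset.sum_congr rfl fun j _ => ?_)))
      · rw [Finset.sum_apply]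
        simp only [Pi.sub_apply, Finset.sum_sub_distrib]
        ring
      · ring
  · refine Or.inl (Or.inr (Set.mem_biUnion (x := A) ?_ ?_))
    · exact Finset.mem_coe.2 (Finset.mem_filter.2 ⟨Finset.mem_univ _, hAK, hAw⟩)
    -- The true active set is itself admissible, because its weight is at most `K`; hence the
    -- minimizer is at least as close as the truth.
    · have := hA _ hw
      simp only [firstPart_received] at this
      refine le_trans (le_of_eq (Finset.sum_congr rfl fun j _ => ?_)) (this.trans (le_of_eq
        (Finset.sum_congr rfl fun j _ => ?_)))
      · ring
      · ring

theorem failureSet_measureReal_le {n₀ n : ℕ} (h : n₀ ≤ n) {ℓ M : ℕ} {P : ℝ} {v : ℝ≥0}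
    (hv : 0 < v) (hvP : v < P) (K : ℝ) (w : Fin ℓ → Fin (M + 1))
    (hw : ((activeSet w).card : ℝ) ≤ K) :
    ((bookLaw v ℓ M n₀ (n - n₀)).prod (noiseLaw n)).real (failureSet h P K w)
      ≤ ℓ * (M + 1) * Real.exp (-(n * powerExponent P v))
        + ∑ A : Finset (Fin ℓ) with (A.card : ℝ) ≤ K ∧ A ≠ activeSet w,
          Real.exp (-(n₀ / 2) * Real.log (1 + (activeSet w ∆ A).card * v / 4))
        + ∑ d : Fin ℓ → Fin (M + 1) with (∀ k, w k ≠ 0 ↔ d k ≠ 0) ∧ d ≠ w,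
          Real.exp (-((n - n₀ : ℕ) / 2) * Real.log (1 + diffCount w d * v / 2)) := by
  refine (measureReal_mono (failureSet_subset h P K w hw)).trans ?_
  refine (measureReal_union_le _ _).trans (add_le_add ((measureReal_union_le _ _).trans
    (add_le_add ?_ ?_)) ?_)
  · refine (measureReal_biUnion_finset_le _ _).trans ?_
    refine (Finset.sum_le_card_nsmul _ _ (Real.exp (-(n * powerExponent P v))) fun kw _ => ?_).trans
      (le_of_eq ?_)
    · refine ENNReal.toReal_le_of_le_ofReal (Real.exp_pos _).le ?_
      rw [Measure.prod_prod, measure_univ, mul_one]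
      exact bookLaw_not_meetsPower_le hv hvP ℓ M h kw.1 kw.2
    · simp
  · refine (measureReal_biUnion_finset_le _ _).trans (Finset.sum_le_sum fun A _ => ?_)
    exact prod_identification_le v ℓ M h _ A
  · refine (measureReal_biUnion_finset_le _ _).trans (Finset.sum_le_sum fun d hd => ?_)
    exact prod_message_le v ℓ M n₀ n (Finset.mem_filter.1 hd).2.1

/-! ### Counting -/

theorem messageProb_nonneg {α : ℝ} (hα : α ∈ Set.Icc (0 : ℝ) 1) (M : ℕ) (w : Fin (M + 1)) :
    0 ≤ messageProb α M w := by
  unfold messageProb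
  split_ifs
  · linarith [hα.2]
  · exact div_nonneg hα.1 (Nat.cast_nonneg M)

theorem messageTupleProb_nonneg {α : ℝ} (hα : α ∈ Set.Icc (0 : ℝ) 1) {ℓ M : ℕ}
    (w : Fin ℓ → Fin (M + 1)) : 0 ≤ messageTupleProb α w :=
  Finset.prod_nonneg fun k _ => messageProb_nonneg hα M (w k)

theorem sum_pi_prod {ι β R : Type*} [Fintype ι] [DecidableEq ι] [Fintype β] [CommSemiring R]
    (f : ι → β → R) : ∑ w : ι → β, ∏ k, f k (w k) = ∏ k, ∑ b, f k b := by
  rw [Finset.prod_univ_sum, Fintype.piFinset_univ]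

/-- Generating function of the number of active users, which is binomial: the sum over tuples
factors over the users. -/
theorem sum_messageTupleProb_mul_pow (α x : ℝ) (ℓ : ℕ) {M : ℕ} (hM : 0 < M) :
    ∑ w : Fin ℓ → Fin (M + 1), messageTupleProb α w * x ^ (activeSet w).card
      = (1 - α + α * x) ^ ℓ := by
  have h : ∀ w : Fin ℓ → Fin (M + 1), messageTupleProb α w * x ^ (activeSet w).card
      = ∏ k, (messageProb α M (w k) * if w k ≠ 0 then x else 1) := by
    intro w
    rw [Finset.prod_mul_distrib, messageTupleProb, activeSet, ← Finset.prod_filter,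
      Finset.prod_const]
  simp_rw [h]
  rw [sum_pi_prod (fun (_ : Fin ℓ) (b : Fin (M + 1)) =>
    messageProb α M b * if b ≠ 0 then x else 1), Finset.prod_const, Finset.card_univ,
    Fintype.card_fin]
  congr 1
  have hM' : (M : ℝ) ≠ 0 := by positivity
  rw [Fin.sum_univ_succ]
  simp only [messageProb, ne_eq, not_true_eq_false, if_false, if_true, Fin.succ_ne_zero,
    not_false_eq_true, Finset.sum_const, Finset.card_univ, Fintype.card_fin, nsmul_eq_mul]
  field_simp

theorem sum_messageTupleProb (α : ℝ) (ℓ : ℕ) {M : ℕ} (hM : 0 < M) :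
    ∑ w : Fin ℓ → Fin (M + 1), messageTupleProb α w = 1 := by
  simpa using sum_messageTupleProb_mul_pow α 1 ℓ hM

/-- Chernoff bound for the number of active users. -/
theorem sum_messageTupleProb_tail_le {α : ℝ} (hα : α ∈ Set.Icc (0 : ℝ) 1) (ℓ : ℕ) {M : ℕ}
    (hM : 0 < M) {δ : ℝ} (hδ₀ : 0 ≤ δ) (hδ₁ : δ ≤ 1) :
    ∑ w : Fin ℓ → Fin (M + 1) with (1 + δ) * (α * ℓ) < (activeSet w).card, messageTupleProb α w
      ≤ Real.exp (-(δ ^ 2 * (α * ℓ) / 4)) := by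
  -- With `exp s - 1 ≤ s + s²` the exponent is at most `(s² - δ s) α ℓ`, which is smallest at `s = δ
  -- / 2`.
  set s : ℝ := δ / 2 with hs
  set K : ℝ := (1 + δ) * (α * ℓ) with hK
  have h1 : ∑ w : Fin ℓ → Fin (M + 1) with K < (activeSet w).card, messageTupleProb α w
      ≤ ∑ w : Fin ℓ → Fin (M + 1),
        Real.exp (-s * K) * (messageTupleProb α w * Real.exp s ^ (activeSet w).card) := by
    rw [Finset.sum_filter]
    refine Finset.sum_le_sum fun w _ => ?_
    have hp := messageTupleProb_nonneg hα w
    split_ifs with hw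
    · have : 1 ≤ Real.exp (-s * K) * Real.exp s ^ (activeSet w).card := by
        rw [← Real.exp_nat_mul, ← Real.exp_add, Real.one_le_exp_iff]
        have := mul_le_mul_of_nonneg_left hw.le (by positivity : 0 ≤ s)
        linarith
      nlinarith
    · positivity
  refine h1.trans ?_
  rw [← Finset.mul_sum, sum_messageTupleProb_mul_pow α _ ℓ hM]
  have hes : Real.exp s - 1 ≤ s + s ^ 2 := by
    have h0 : |s| ≤ 1 := by rw [abs_of_nonneg (by positivity)]; linarith
    have := (abs_le.1 (Real.abs_exp_sub_one_sub_id_le h0)).2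
    linarith
  have hbase : 1 - α + α * Real.exp s ≤ Real.exp (α * (s + s ^ 2)) := by
    refine le_trans ?_ (Real.add_one_le_exp _)
    nlinarith [hα.1]
  have h0 : 0 ≤ 1 - α + α * Real.exp s :=
    add_nonneg (by linarith [hα.2]) (mul_nonneg hα.1 (Real.exp_pos s).le)
  refine (mul_le_mul_of_nonneg_left (pow_le_pow_left₀ h0 hbase ℓ) (Real.exp_pos _).le).trans ?_
  rw [← Real.exp_nat_mul, ← Real.exp_add, Real.exp_le_exp]
  apply le_of_eq
  rw [hK, hs]
  ring

/-- The number of sets of at most `(1 + δ) α ℓ` out of `ℓ` users. -/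
theorem card_filter_card_le {α : ℝ} (hα₀ : 0 < α) (hα₁ : α ≤ 1) (ℓ : ℕ) {δ : ℝ} (hδ : 0 ≤ δ) :
    ((Finset.univ.filter fun A : Finset (Fin ℓ) => (A.card : ℝ) ≤ (1 + δ) * (α * ℓ)).card : ℝ)
      ≤ Real.exp ((1 + δ) * (ℓ * Real.binEntropy α) + 2 * (α * ℓ)) := by
  have hℓ : (0 : ℝ) ≤ ℓ := Nat.cast_nonneg ℓ
  have hent : 0 ≤ Real.binEntropy α := Real.binEntropy_nonneg hα₀.le hα₁
  rcases le_or_gt α (1 / 2) with h | h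
  · set K : ℝ := (1 + δ) * (α * ℓ) with hK
    have h1α : 0 < 1 - α := by linarith
    set c : ℝ := K * Real.log α + (ℓ - K) * Real.log (1 - α) with hc
    -- When each user is chosen independently with probability `α ≤ 1/2`, smaller sets are likelier,
    -- so each set counted has probability at least `exp c`. The probabilities sum to `1`, hence
    -- there are at most `exp (-c)` such sets.
    have hterm : ∀ A ∈ Finset.univ.filter fun A : Finset (Fin ℓ) => (A.card : ℝ) ≤ K,
        (1 : ℝ) ≤ Real.exp (-c) * (α ^ A.card * (1 - α) ^ (ℓ - A.card)) := by
      intro A hA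
      have hAK : (A.card : ℝ) ≤ K := (Finset.mem_filter.1 hA).2
      have hAℓ : A.card ≤ ℓ := by simpa using A.card_le_univ
      have h2 : α ^ A.card * (1 - α) ^ (ℓ - A.card)
          = Real.exp (A.card * Real.log α + (ℓ - A.card) * Real.log (1 - α)) := by
        rw [Real.exp_add, Real.exp_nat_mul, Real.exp_log hα₀, ← Nat.cast_sub hAℓ,
          Real.exp_nat_mul, Real.exp_log h1α]
      rw [h2, ← Real.exp_add, Real.one_le_exp_iff]
      have hlog : Real.log α ≤ Real.log (1 - α) := Real.log_le_log hα₀ (by linarith)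
      nlinarith [mul_nonneg (sub_nonneg.2 hAK) (sub_nonneg.2 hlog)]
    have hcount : ((Finset.univ.filter fun A : Finset (Fin ℓ) => (A.card : ℝ) ≤ K).card : ℝ)
        ≤ Real.exp (-c) := by
      rw [Finset.card_eq_sum_ones, Nat.cast_sum]
      refine (Finset.sum_le_sum fun A hA => (by simpa using hterm A hA)).trans
        ((Finset.sum_le_sum_of_subset_of_nonneg (Finset.subset_univ _) fun A _ _ => ?_).trans
        (le_of_eq ?_) (b := ∑ A : Finset (Fin ℓ),
          Real.exp (-c) * (α ^ A.card * (1 - α) ^ (ℓ - A.card))))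
      · positivity
      · rw [← Finset.mul_sum]
        have := Fintype.sum_pow_mul_eq_add_pow (Fin ℓ) α (1 - α)
        rw [Fintype.card_fin] at this
        rw [this]
        simp
    refine hcount.trans (Real.exp_le_exp.2 ?_)
    have hl1 : Real.log (1 - α) ≤ 0 := Real.log_nonpos h1α.le (by linarith)
    rw [hc, hK, Real.binEntropy, Real.log_inv, Real.log_inv]
    nlinarith [mul_nonneg (mul_nonneg hδ hℓ) (neg_nonneg.2 hl1), mul_nonneg hα₀.le hℓ]
  -- For `α > 1/2` the trivial count suffices: `2 ^ ℓ ≤ exp ℓ ≤ exp (2 α ℓ)`. This case is the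
  -- source of the term `2 α ℓ`.
  · have h1 : ((Finset.univ.filter fun A : Finset (Fin ℓ) =>
        (A.card : ℝ) ≤ (1 + δ) * (α * ℓ)).card : ℝ) ≤ 2 ^ ℓ := by
      have := Finset.card_le_univ
        (Finset.univ.filter fun A : Finset (Fin ℓ) => (A.card : ℝ) ≤ (1 + δ) * (α * ℓ))
      rw [Fintype.card_finset, Fintype.card_fin] at this
      exact_mod_cast this
    refine h1.trans ?_
    have h2 : (2 : ℝ) ^ ℓ ≤ Real.exp ℓ := by
      rw [← mul_one (ℓ : ℝ), Real.exp_nat_mul]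
      exact pow_le_pow_left₀ (by norm_num) (by linarith [Real.add_one_le_exp (1 : ℝ)]) ℓ
    refine h2.trans (Real.exp_le_exp.2 ?_)
    have : 0 ≤ (1 + δ) * (ℓ * Real.binEntropy α) := by positivity
    nlinarith

theorem one_add_pow_le_exp {x : ℝ} (hx : 0 ≤ x) (m : ℕ) : (1 + x) ^ m ≤ Real.exp (m * x) := by
  rw [Real.exp_nat_mul]
  exact pow_le_pow_left₀ (by linarith) (by linarith [Real.add_one_le_exp x]) m

/-- The part `x ^ u` is summed over all sets: `A ↦ A₀ ∆ A` is a bijection, so the total is `(1 + x)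
^ ℓ`, from which the term `1` of `A₀` is removed. The constant part `y` is paid once per admissible
set. -/
theorem sum_identification_le {ℓ : ℕ} (A₀ : Finset (Fin ℓ)) (K : ℝ) (f : ℕ → ℝ) {x y N : ℝ}
    (hx : 0 ≤ x) (hy : 0 ≤ y)
    (hN : ((Finset.univ.filter fun A : Finset (Fin ℓ) => (A.card : ℝ) ≤ K).card : ℝ) ≤ N)
    (hf : ∀ u, 1 ≤ u → f u ≤ x ^ u + y) :
    ∑ A : Finset (Fin ℓ) with (A.card : ℝ) ≤ K ∧ A ≠ A₀, f (A₀ ∆ A).card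
      ≤ (Real.exp (ℓ * x) - 1) + N * y := by
  have h1 : ∑ A : Finset (Fin ℓ) with (A.card : ℝ) ≤ K ∧ A ≠ A₀, f (A₀ ∆ A).card
      ≤ ∑ A : Finset (Fin ℓ) with (A.card : ℝ) ≤ K ∧ A ≠ A₀, x ^ (A₀ ∆ A).card
        + ∑ A : Finset (Fin ℓ) with (A.card : ℝ) ≤ K ∧ A ≠ A₀, y := by
    rw [← Finset.sum_add_distrib]
    refine Finset.sum_le_sum fun A hA => hf _ ?_
    have hne := (Finset.mem_filter.1 hA).2.2
    refine Finset.card_pos.2 (Finset.nonempty_iff_ne_empty.2 fun h0 => hne ?_)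
    exact (symmDiff_eq_bot.1 h0).symm
  refine h1.trans (add_le_add ?_ ?_)
  · have h2 : ∑ A : Finset (Fin ℓ), x ^ (A₀ ∆ A).card = (1 + x) ^ ℓ := by
      have := (Equiv.sum_comp (symmDiff_right_involutive A₀).toPerm
        fun A : Finset (Fin ℓ) => x ^ A.card)
      refine (Eq.trans ?_ this).trans ?_
      · rfl
      · have := Fintype.sum_pow_mul_eq_add_pow (Fin ℓ) x 1
        rw [Fintype.card_fin] at this
        rw [add_comm, ← this]
        simp
    have h3 : ∑ A : Finset (Fin ℓ) with (A.card : ℝ) ≤ K ∧ A ≠ A₀, x ^ (A₀ ∆ A).card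
        ≤ ∑ A ∈ Finset.univ.erase A₀, x ^ (A₀ ∆ A).card := by
      refine Finset.sum_le_sum_of_subset_of_nonneg (fun A hA => ?_) fun A _ _ => by positivity
      exact Finset.mem_erase.2 ⟨(Finset.mem_filter.1 hA).2.2, Finset.mem_univ _⟩
    have h4 := Finset.sum_erase_add Finset.univ
      (fun A : Finset (Fin ℓ) => x ^ (A₀ ∆ A).card) (Finset.mem_univ A₀)
    rw [h2] at h4
    simp only [symmDiff_self, Finset.bot_eq_empty, Finset.card_empty, pow_zero] at h4
    have := one_add_pow_le_exp hx ℓ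
    linarith
  · rw [Finset.sum_const, nsmul_eq_mul]
    refine mul_le_mul_of_nonneg_right (le_trans ?_ hN) hy
    exact_mod_cast Finset.card_le_card fun A hA => by
      simp only [Finset.mem_filter, Finset.mem_univ, true_and] at hA ⊢
      exact hA.1

/-- The sum factors over the users: a silent user contributes `1`, and an active one at most `1 + M
x`, for its true message and its wrong ones. -/
theorem sum_pow_diffCount_le {ℓ M : ℕ} (w : Fin ℓ → Fin (M + 1)) {x : ℝ} (hx : 0 ≤ x) :
    ∑ d : Fin ℓ → Fin (M + 1) with (∀ k, w k ≠ 0 ↔ d k ≠ 0), x ^ diffCount w d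
      ≤ Real.exp ((activeSet w).card * (M * x)) := by
  have h1 : ∀ d : Fin ℓ → Fin (M + 1), x ^ diffCount w d
      = ∏ k, if w k ≠ d k then x else 1 := by
    intro d
    rw [diffCount, ← Finset.prod_filter, Finset.prod_const]
  have h2 : (Finset.univ.filter fun d : Fin ℓ → Fin (M + 1) => ∀ k, w k ≠ 0 ↔ d k ≠ 0)
      = Fintype.piFinset fun k => Finset.univ.filter fun b => (w k ≠ 0 ↔ b ≠ 0) := by
    ext d; simp
  simp_rw [h1]
  rw [h2, ← Finset.prod_univ_sum (fun k => Finset.univ.filter fun b => (w k ≠ 0 ↔ b ≠ 0))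
    fun k b => if w k ≠ b then x else 1]
  refine le_trans (Finset.prod_le_prod (g := fun k => if w k ≠ 0 then 1 + M * x else 1)
    (fun k _ => Finset.sum_nonneg fun b _ => by split_ifs <;> positivity) fun k _ => ?_) ?_
  · split_ifs with hk
    · calc ∑ b : Fin (M + 1) with (w k ≠ 0 ↔ b ≠ 0), (if w k ≠ b then x else 1)
          ≤ ∑ b ∈ Finset.univ.erase 0, (if w k ≠ b then x else 1) := by
            refine Finset.sum_le_sum_of_subset_of_nonneg (fun b hb => ?_)
              fun b _ _ => by split_ifs <;> positivity
            exact Finset.mem_erase.2 ⟨(Finset.mem_filter.1 hb).2.1 hk, Finset.mem_univ _⟩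
        _ ≤ ∑ b ∈ Finset.univ.erase 0, (x + if w k = b then 1 else 0) := by
            refine Finset.sum_le_sum fun b _ => ?_
            by_cases h : w k = b <;> simp [h, hx]
        _ ≤ 1 + M * x := by
            rw [Finset.sum_add_distrib, Finset.sum_const, Finset.card_erase_of_mem
              (Finset.mem_univ _), Finset.sum_ite_eq, Finset.card_univ, Fintype.card_fin]
            simp [hk, add_comm]
    · rw [not_not] at hk
      have : (Finset.univ.filter fun b : Fin (M + 1) => (w k ≠ 0 ↔ b ≠ 0)) = {0} := by
        ext b; simp [hk]
      rw [this, Finset.sum_singleton, hk]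
      simp
  · rw [← Finset.prod_filter, Finset.prod_const]
    exact one_add_pow_le_exp (by positivity) _

theorem diffCount_le_card_activeSet {ℓ M : ℕ} {w d : Fin ℓ → Fin (M + 1)}
    (h : ∀ k, w k ≠ 0 ↔ d k ≠ 0) : diffCount w d ≤ (activeSet w).card := by
  refine Finset.card_le_card fun k hk => ?_
  rw [mem_activeSet]
  intro h0
  have hd : d k = 0 := not_not.1 fun hd => (h k).2 hd h0
  exact (Finset.mem_filter.1 hk).2 (h0.trans hd.symm)

theorem diffCount_pos {ℓ M : ℕ} {w d : Fin ℓ → Fin (M + 1)} (h : d ≠ w) : 0 < diffCount w d := by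
  obtain ⟨k, hk⟩ := Function.ne_iff.1 h
  exact Finset.card_pos.2 ⟨k, Finset.mem_filter.2 ⟨Finset.mem_univ _, hk.symm⟩⟩

theorem sum_message_le {ℓ M : ℕ} (w : Fin ℓ → Fin (M + 1)) (f : ℕ → ℝ) {x y z : ℝ}
    (hx : 0 ≤ x) (hy : 0 ≤ y) (hz : 0 ≤ z)
    (hf : ∀ u, 1 ≤ u → u ≤ (activeSet w).card → f u ≤ x ^ u + y * z ^ u) :
    ∑ d : Fin ℓ → Fin (M + 1) with (∀ k, w k ≠ 0 ↔ d k ≠ 0) ∧ d ≠ w, f (diffCount w d)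
      ≤ (Real.exp ((activeSet w).card * (M * x)) - 1)
        + y * Real.exp ((activeSet w).card * (M * z)) := by
  have hS : (Finset.univ.filter fun d : Fin ℓ → Fin (M + 1) =>
      (∀ k, w k ≠ 0 ↔ d k ≠ 0) ∧ d ≠ w)
      = (Finset.univ.filter fun d : Fin ℓ → Fin (M + 1) => ∀ k, w k ≠ 0 ↔ d k ≠ 0).erase w := by
    ext d
    simp only [Finset.mem_filter, Finset.mem_univ, true_and, Finset.mem_erase]
    exact and_comm
  rw [hS]
  set S := Finset.univ.filter fun d : Fin ℓ → Fin (M + 1) => ∀ k, w k ≠ 0 ↔ d k ≠ 0 with hSdef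
  have hw : w ∈ S := by simp [hSdef]
  calc ∑ d ∈ S.erase w, f (diffCount w d)
      ≤ ∑ d ∈ S.erase w, (x ^ diffCount w d + y * z ^ diffCount w d) := by
        refine Finset.sum_le_sum fun d hd => hf _ (diffCount_pos (Finset.mem_erase.1 hd).1) ?_
        exact diffCount_le_card_activeSet (Finset.mem_filter.1 (Finset.mem_erase.1 hd).2).2
    _ = ∑ d ∈ S.erase w, x ^ diffCount w d + y * ∑ d ∈ S.erase w, z ^ diffCount w d := by
        rw [Finset.sum_add_distrib, Finset.mul_sum]
    _ ≤ _ := by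
        refine add_le_add ?_ (mul_le_mul_of_nonneg_left ?_ hy)
        · have h1 := Finset.sum_erase_add S (fun d => x ^ diffCount w d) hw
          have h2 : diffCount w w = 0 := by simp [diffCount]
          simp only [h2, pow_zero] at h1
          have := sum_pow_diffCount_le w hx
          linarith
        · exact (Finset.sum_le_sum_of_subset_of_nonneg (Finset.erase_subset _ _)
            fun d _ _ => by positivity).trans (sum_pow_diffCount_le w hz)

/-- A bound on the failure probability of the two-stage scheme with `(1 + δ) α ℓ` as weight
bound, from bounds on the pairwise error probabilities of the two stages. -/
theorem twoStageFailureProb_le {n₀ n : ℕ} (h : n₀ ≤ n) {ℓ M : ℕ} (hℓ : 0 < ℓ) (hM : 0 < M)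
    {α P : ℝ} {v : ℝ≥0} (hα₀ : 0 < α) (hα₁ : α ≤ 1) (hv : 0 < v) (hvP : v < P) {δ : ℝ}
    (hδ₀ : 0 ≤ δ) (hδ₁ : δ ≤ 1)
    (hid : ∀ u : ℕ, 1 ≤ u → Real.exp (-(n₀ / 2) * Real.log (1 + u * v / 4))
      ≤ (1 / (ℓ : ℝ) ^ 2) ^ u
        + Real.exp (-((1 + δ) * (ℓ * Real.binEntropy α) + 3 * (α * ℓ))))
    (hmsg : ∀ u : ℕ, 1 ≤ u → (u : ℝ) ≤ (1 + δ) * (α * ℓ) →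
      Real.exp (-((n - n₀ : ℕ) / 2) * Real.log (1 + u * v / 2))
      ≤ (1 / (M * (α * ℓ) ^ 2)) ^ u + Real.exp (-(3 * (α * ℓ))) * (1 / (M : ℝ)) ^ u) :
    twoStageFailureProb h ℓ M α P v ((1 + δ) * (α * ℓ))
      ≤ Real.exp (-(δ ^ 2 * (α * ℓ) / 4))
        + (ℓ * (M + 1) * Real.exp (-(n * powerExponent P v))
          + ((Real.exp (1 / ℓ) - 1) + Real.exp (-(α * ℓ)))
          + ((Real.exp (2 / (α * ℓ)) - 1) + Real.exp (-(α * ℓ)))) := by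
  have hℓ' : (0 : ℝ) < ℓ := by exact_mod_cast hℓ
  have hM' : (0 : ℝ) < M := by exact_mod_cast hM
  set k : ℝ := α * ℓ with hk
  have hk0 : 0 < k := by positivity
  set K : ℝ := (1 + δ) * k with hK
  have hK2 : K ≤ 2 * k := by rw [hK]; nlinarith
  set R : ℝ := ℓ * (M + 1) * Real.exp (-(n * powerExponent P v))
          + ((Real.exp (1 / ℓ) - 1) + Real.exp (-k))
          + ((Real.exp (2 / k) - 1) + Real.exp (-k)) with hR
  have hR0 : 0 ≤ R := by
    have h1 : 1 ≤ Real.exp (1 / ℓ) := Real.one_le_exp (by positivity)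
    have h2 : 1 ≤ Real.exp (2 / k) := Real.one_le_exp (by positivity)
    have h3 : 0 ≤ ℓ * (M + 1) * Real.exp (-(n * powerExponent P v)) := by positivity
    have h4 := Real.exp_pos (-k)
    rw [hR]
    linarith
  have hgood : ∀ w : Fin ℓ → Fin (M + 1), ((activeSet w).card : ℝ) ≤ K →
      ((bookLaw v ℓ M n₀ (n - n₀)).prod (noiseLaw n)).real (failureSet h P K w) ≤ R := by
    intro w hw
    refine (failureSet_measureReal_le h hv hvP K w hw).trans
      (add_le_add (add_le_add le_rfl ?_) ?_)
    · refine (sum_identification_le (activeSet w) K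
        (fun u => Real.exp (-(n₀ / 2) * Real.log (1 + u * v / 4))) (by positivity)
        (Real.exp_pos _).le (card_filter_card_le hα₀ hα₁ ℓ hδ₀) hid).trans
        (add_le_add (le_of_eq ?_) (le_of_eq ?_))
      · congr 2; field_simp
      -- The pairwise bound has `3 α ℓ` where the count of sets has `2 α ℓ`; the difference leaves
      -- `exp (-α ℓ)`.
      · rw [← Real.exp_add]
        congr 1; ring
    · refine (sum_message_le w
        (fun u => Real.exp (-((n - n₀ : ℕ) / 2) * Real.log (1 + u * v / 2)))
        (by positivity) (Real.exp_pos _).le (by positivity)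
        fun u hu hu' => hmsg u hu (le_trans (by exact_mod_cast hu') hw)).trans
        (add_le_add (sub_le_sub_right (Real.exp_le_exp.2 ?_) 1) ?_)
      · have : ((activeSet w).card : ℝ) * (M * (1 / (M * k ^ 2))) = (activeSet w).card / k ^ 2 := by
          field_simp
        rw [this, div_le_div_iff₀ (by positivity) hk0]
        nlinarith [hw.trans hK2]
      · rw [← Real.exp_add, Real.exp_le_exp]
        have : ((activeSet w).card : ℝ) * (M * (1 / (M : ℝ))) = (activeSet w).card := by
          field_simp
        rw [this]
        linarith
  -- Tuples with more than `K` active users are charged failure probability `1`, since the true set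
  -- is then not a candidate.
  have hsplit : ∀ w : Fin ℓ → Fin (M + 1), messageTupleProb α w *
      ((bookLaw v ℓ M n₀ (n - n₀)).prod (noiseLaw n)).real (failureSet h P K w)
      ≤ (if K < (activeSet w).card then messageTupleProb α w else 0)
        + messageTupleProb α w * R := by
    intro w
    have hp := messageTupleProb_nonneg ⟨hα₀.le, hα₁⟩ w
    split_ifs with hw
    · have := mul_le_mul_of_nonneg_left (measureReal_le_one
        (μ := (bookLaw v ℓ M n₀ (n - n₀)).prod (noiseLaw n)) (s := failureSet h P K w)) hp
      have := mul_nonneg hp hR0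
      linarith
    · rw [zero_add]
      exact mul_le_mul_of_nonneg_left (hgood w (not_lt.1 hw)) hp
  calc twoStageFailureProb h ℓ M α P v K
      ≤ ∑ w : Fin ℓ → Fin (M + 1), ((if K < (activeSet w).card then messageTupleProb α w else 0)
        + messageTupleProb α w * R) := Finset.sum_le_sum fun w _ => hsplit w
    _ = ∑ w : Fin ℓ → Fin (M + 1) with K < (activeSet w).card, messageTupleProb α w + R := by
        rw [Finset.sum_add_distrib, Finset.sum_filter, ← Finset.sum_mul,
          sum_messageTupleProb α ℓ hM, one_mul]
    _ ≤ _ := add_le_add (sum_messageTupleProb_tail_le ⟨hα₀.le, hα₁⟩ ℓ hM hδ₀ hδ₁) le_rfl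

/-! ### Instances of the two-stage scheme -/

/-- Ties are broken by the first admissible element in an enumeration of `D`. -/
theorem exists_measurable_selection {X D : Type*} [MeasurableSpace X] [MeasurableSpace D]
    [Countable D] [Nonempty D] (S : X → D → Prop) (hS : ∀ d, MeasurableSet {x | S x d})
    (h : ∀ x, ∃ d, S x d) : ∃ f : X → D, Measurable f ∧ ∀ x, S x (f x) := by
  classical
  obtain ⟨e, he⟩ := exists_surjective_nat D
  have h' : ∀ x, ∃ N, S x (e N) := fun x => by
    obtain ⟨d, hd⟩ := h x
    obtain ⟨N, rfl⟩ := he d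
    exact ⟨N, hd⟩
  exact ⟨fun x => e (Nat.find (h' x)),
    (measurable_from_nat (f := e)).comp (measurable_find h' fun N => hS (e N)),
    fun x => Nat.find_spec (h' x)⟩

theorem exists_isTwoStageOutput {ℓ M n₀ n : ℕ} (hM : 0 < M) (h : n₀ ≤ n)
    (b : TwoStageBook ℓ M n₀ (n - n₀)) {K : ℝ} (hK : 0 ≤ K) (y : Fin n → ℝ) :
    ∃ d, IsTwoStageOutput h b K y d := by
  classical
  obtain ⟨A, hA, hAmin⟩ := Finset.exists_min_image
    (Finset.univ.filter fun A : Finset (Fin ℓ) => (A.card : ℝ) ≤ K)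
    (fun A => ∑ i, (firstPart h y i - ∑ k ∈ A, b.1 k i) ^ 2) ⟨∅, by simpa using hK⟩
  obtain ⟨d, hd, hdmin⟩ := Finset.exists_min_image
    (Finset.univ.filter fun d : Fin ℓ → Fin (M + 1) => ∀ k, d k ≠ 0 ↔ k ∈ A)
    (fun d => ∑ j, (lastPart n₀ y j - ∑ k, msgWord (b.2 k) (d k) j) ^ 2)
    ⟨fun k => if k ∈ A then Fin.last M else 0, by
      refine Finset.mem_filter.2 ⟨Finset.mem_univ _, fun k => ?_⟩
      have hlast : Fin.last M ≠ 0 := fun h0 => hM.ne' (congrArg Fin.val h0)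
      by_cases hk : k ∈ A
      · simp only [if_pos hk]; exact iff_of_true hlast hk
      · simp only [if_neg hk]; exact iff_of_false (not_not.2 rfl) hk⟩
  simp only [Finset.mem_filter, Finset.mem_univ, true_and] at hA hAmin hd hdmin
  exact ⟨d, A, ⟨hA, hAmin⟩, hd, hdmin⟩

theorem measurableSet_isTwoStageOutput {ℓ M n₀ n : ℕ} (h : n₀ ≤ n)
    (b : TwoStageBook ℓ M n₀ (n - n₀)) (K : ℝ) (d : Fin ℓ → Fin (M + 1)) :
    MeasurableSet {y : Fin n → ℝ | IsTwoStageOutput h b K y d} := by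
  have h1 : ∀ i, Measurable fun y : Fin n → ℝ => firstPart h y i :=
    fun i => measurable_pi_apply _
  have h2 : ∀ j, Measurable fun y : Fin n → ℝ => lastPart n₀ y j :=
    fun j => measurable_pi_apply _
  simp only [IsTwoStageOutput, IsLeastSquaresSet, IsMaxLikelihood, Set.ofPred_exists,
    Set.ofPred_and, Set.ofPred_forall]
  refine MeasurableSet.iUnion fun A => MeasurableSet.inter (MeasurableSet.inter ?_ ?_)
    (MeasurableSet.inter ?_ ?_)
  · exact MeasurableSet.const _
  · refine MeasurableSet.iInter fun A' => MeasurableSet.iInter fun _ => ?_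
    exact measurableSet_le (by fun_prop) (by fun_prop)
  · exact MeasurableSet.iInter fun k => MeasurableSet.const _
  · refine MeasurableSet.iInter fun d' => MeasurableSet.iInter fun _ => ?_
    exact measurableSet_le (by fun_prop) (by fun_prop)

/-- Every codebook that meets the power constraint is the codebook of a two-stage code. -/
theorem exists_code_of_book {ℓ M n₀ n : ℕ} (hM : 0 < M) (h : n₀ ≤ n) {P K : ℝ} (hK : 0 ≤ K)
    (b : TwoStageBook ℓ M n₀ (n - n₀))
    (hb : ∀ k w, MeetsPower P (twoStageCodeword (n := n) b k w)) :
    ∃ C : SymmetricCode ℓ M n P, C.encode = twoStageCodeword b ∧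
      ∀ y, IsTwoStageOutput h b K y (C.decode y) := by
  obtain ⟨f, hf, hfS⟩ := exists_measurable_selection (IsTwoStageOutput h b K)
    (measurableSet_isTwoStageOutput h b K) (exists_isTwoStageOutput hM h b hK)
  exact ⟨⟨twoStageCodeword b, fun k => by ext i; simp [twoStageCodeword], hb, f, hf⟩, rfl, hfS⟩

/-- Replacing `s` by its measurable hull avoids any measurability proof for the failure event. -/
theorem lintegral_section_le {X Y : Type*} [MeasurableSpace X] [MeasurableSpace Y]
    (μ : Measure X) (ν : Measure Y) [SFinite ν] (s : Set (X × Y)) :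
    ∃ g : X → ℝ≥0∞, Measurable g ∧ (∀ x, ν {y | (x, y) ∈ s} ≤ g x)
      ∧ ∫⁻ x, g x ∂μ = (μ.prod ν) s := by
  refine ⟨fun x => ν (Prod.mk x ⁻¹' toMeasurable (μ.prod ν) s),
    measurable_measure_prodMk_left (measurableSet_toMeasurable _ _), fun x => ?_, ?_⟩
  · exact measure_mono fun y hy => subset_toMeasurable _ _ hy
  · rw [← Measure.prod_apply (measurableSet_toMeasurable _ _), measure_toMeasurable]

/-- Some codebook has conditional failure probability at most the average one. -/
theorem exists_book_failure_le {n₀ n : ℕ} (h : n₀ ≤ n) (ℓ M : ℕ) {α : ℝ}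
    (hα : α ∈ Set.Icc (0 : ℝ) 1) (P : ℝ) (v : ℝ≥0) (K : ℝ) :
    ∃ b : TwoStageBook ℓ M n₀ (n - n₀), ∑ w : Fin ℓ → Fin (M + 1), messageTupleProb α w *
      (noiseLaw n).real {z | (b, z) ∈ failureSet h P K w}
        ≤ twoStageFailureProb h ℓ M α P v K := by
  choose g hgm hg hgI using fun w : Fin ℓ → Fin (M + 1) =>
    lintegral_section_le (bookLaw v ℓ M n₀ (n - n₀)) (noiseLaw n) (failureSet h P K w)
  obtain ⟨b, hb⟩ := exists_le_lintegral (μ := bookLaw v ℓ M n₀ (n - n₀))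
    (f := fun b => ∑ w, ENNReal.ofReal (messageTupleProb α w) * g w b)
    (by fun_prop)
  refine ⟨b, ?_⟩
  rw [lintegral_finsetSum _ fun w _ => (hgm w).const_mul _] at hb
  simp_rw [lintegral_const_mul _ (hgm _), hgI] at hb
  have h1 : ∀ (p : ℝ) (_ : 0 ≤ p) {Z : Type} [MeasurableSpace Z] (μ : Measure Z)
      [IsProbabilityMeasure μ] (s : Set Z),
      ENNReal.ofReal p * μ s = ENNReal.ofReal (p * μ.real s) := by
    intro p hp Z _ μ _ s
    rw [ENNReal.ofReal_mul hp, measureReal_def, ENNReal.ofReal_toReal (measure_ne_top _ _)]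
  have h2 : ∑ w : Fin ℓ → Fin (M + 1), ENNReal.ofReal (messageTupleProb α w) *
      noiseLaw n {z | (b, z) ∈ failureSet h P K w}
      ≤ ∑ w : Fin ℓ → Fin (M + 1), ENNReal.ofReal (messageTupleProb α w) *
        ((bookLaw v ℓ M n₀ (n - n₀)).prod (noiseLaw n)) (failureSet h P K w) :=
    (Finset.sum_le_sum fun w _ => mul_le_mul_right (hg w b) _).trans hb
  simp_rw [h1 _ (messageTupleProb_nonneg hα _)] at h2
  rw [← ENNReal.ofReal_sum_of_nonneg fun w _ =>
      mul_nonneg (messageTupleProb_nonneg hα w) measureReal_nonneg,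
    ← ENNReal.ofReal_sum_of_nonneg fun w _ =>
      mul_nonneg (messageTupleProb_nonneg hα w) measureReal_nonneg] at h2
  exact (ENNReal.ofReal_le_ofReal_iff (Finset.sum_nonneg fun w _ =>
    mul_nonneg (messageTupleProb_nonneg hα w) measureReal_nonneg)).1 h2

/-- There is a two-stage code whose average error probability is at most the failure probability
of the random two-stage scheme, provided that the latter is less than one. -/
theorem exists_twoStageCode {n₀ n : ℕ} (h : n₀ ≤ n) (ℓ : ℕ) {M : ℕ} (hM : 0 < M) {α : ℝ}
    (hα : α ∈ Set.Icc (0 : ℝ) 1) {P : ℝ} (hP : 0 ≤ P) (v : ℝ≥0) {K : ℝ} (hK : 0 ≤ K) :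
    ∃ C : SymmetricCode ℓ M n P, IsTwoStageCode h K C ∧
      (twoStageFailureProb h ℓ M α P v K < 1 →
        C.errorProb α ≤ twoStageFailureProb h ℓ M α P v K) := by
  by_cases hlt : twoStageFailureProb h ℓ M α P v K < 1
  · obtain ⟨b, hb⟩ := exists_book_failure_le h ℓ M hα P v K
    have hpow : ∀ k w, MeetsPower P (twoStageCodeword (n := n) b k w) := by
      by_contra hc
      push Not at hc
      have : ∀ w : Fin ℓ → Fin (M + 1),
          {z : Fin n → ℝ | (b, z) ∈ failureSet h P K w} = Set.univ :=
        fun w => Set.eq_univ_of_forall fun z => Or.inl hc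
      simp_rw [this] at hb
      simp only [probReal_univ, mul_one] at hb
      rw [sum_messageTupleProb α ℓ hM] at hb
      linarith
    obtain ⟨C, hC, hdec⟩ := exists_code_of_book hM h hK b hpow
    refine ⟨C, ⟨b, hC, hdec⟩, fun _ => le_trans ?_ hb⟩
    refine Finset.sum_le_sum fun w _ =>
      mul_le_mul_of_nonneg_left (measureReal_mono fun z hz => ?_) (messageTupleProb_nonneg hα w)
    refine Or.inr ⟨C.decode (received C.encode w z), ?_, hz⟩
    rw [← hC]
    exact hdec _
  -- The error bound is vacuous here, but a code of the class is still needed at every blocklength;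
  -- the zero codebook meets the power constraint.
  · have hpow : ∀ (k : Fin ℓ) (w : Fin (M + 1)), MeetsPower P (twoStageCodeword (n := n)
        (0 : TwoStageBook ℓ M n₀ (n - n₀)) k w) := by
      intro k w
      have : twoStageCodeword (n := n) (0 : TwoStageBook ℓ M n₀ (n - n₀)) k w = 0 := by
        ext i
        induction w using Fin.cases with
        | zero => simp [twoStageCodeword]
        | succ m => simp [twoStageCodeword]
      rw [this]
      simp [MeetsPower, hP]
    obtain ⟨C, hC, hdec⟩ := exists_code_of_book hM h hK 0 hpow
    exact ⟨C, ⟨0, hC, hdec⟩, fun h' => absurd h' hlt⟩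

/-! ### Exponents of the pairwise error probabilities -/

/-- Bernoulli's inequality, that is, concavity of the logarithm on the segment from `1` to `1 + x`.
-/
theorem mul_log_one_add_le {t x : ℝ} (ht₀ : 0 ≤ t) (ht₁ : t ≤ 1) (hx : 0 ≤ x) :
    t * Real.log (1 + x) ≤ Real.log (1 + t * x) := by
  rw [← Real.log_rpow (by linarith)]
  exact Real.log_le_log (Real.rpow_pos_of_pos (by linarith) t)
    (rpow_one_add_le_one_add_mul_self (by linarith) ht₀ ht₁)

/-- For `u ≤ k / A`, concavity compares `log (1 + u c)` with its value at `u = k / A`, and `h1`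
yields an exponent of at least `2 u log ℓ`. For `u > k / A`, monotonicity and `h2` yield at least
`T`. -/
theorem exp_identification_le {ℓ m k c A T : ℝ} (hℓ : 0 < ℓ) (hm : 0 ≤ m) (hk : 0 < k)
    (hc : 0 < c) (hA : 0 < A)
    (h1 : 2 * Real.log ℓ ≤ m / 2 * (A / k * Real.log (1 + k / A * c)))
    (h2 : T ≤ m / 2 * Real.log (1 + k / A * c)) (u : ℕ) :
    Real.exp (-(m / 2) * Real.log (1 + u * c)) ≤ (1 / ℓ ^ 2) ^ u + Real.exp (-T) := by
  have hu : (0 : ℝ) ≤ u := Nat.cast_nonneg u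
  rcases le_or_gt (u * A) k with hle | hgt
  · have h3 := mul_log_one_add_le (t := u * A / k) (x := k / A * c) (by positivity)
      ((div_le_one hk).2 hle) (by positivity)
    rw [show u * A / k * (k / A * c) = u * c by field_simp] at h3
    have h4 : (1 / ℓ ^ 2) ^ u = Real.exp (-(u * (2 * Real.log ℓ))) := by
      rw [← mul_neg, Real.exp_nat_mul, Real.exp_neg]
      congr 1
      rw [show (2 : ℝ) * Real.log ℓ = (2 : ℕ) * Real.log ℓ by norm_num, Real.exp_nat_mul,
        Real.exp_log hℓ, one_div]
    have h5 : Real.exp (-(m / 2) * Real.log (1 + u * c)) ≤ (1 / ℓ ^ 2) ^ u := by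
      rw [h4, Real.exp_le_exp]
      have h6 := mul_le_mul_of_nonneg_left h1 hu
      have h7 := mul_le_mul_of_nonneg_left h3 (by positivity : 0 ≤ m / 2)
      have h8 : (u : ℝ) * (m / 2 * (A / k * Real.log (1 + k / A * c)))
        = m / 2 * (u * A / k * Real.log (1 + k / A * c)) := by ring
      linarith
    linarith [Real.exp_pos (-T)]
  · have h3 : Real.log (1 + k / A * c) ≤ Real.log (1 + u * c) := by
      refine Real.log_le_log (by positivity) ?_
      have : k / A ≤ u := (div_le_iff₀ hA).2 hgt.le
      nlinarith
    have h5 : Real.exp (-(m / 2) * Real.log (1 + u * c)) ≤ Real.exp (-T) := by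
      rw [Real.exp_le_exp]
      have h7 := mul_le_mul_of_nonneg_left h3 (by positivity : 0 ≤ m / 2)
      linarith
    have : 0 ≤ (1 / ℓ ^ 2) ^ u := by positivity
    linarith

/-- For `u ≤ k / A` the argument is that of identification. For `k / A < u ≤ K`, concavity compares
with `u = K`, so the exponent is at least `u (log M + 3 A)`, and `u A > k` turns the surplus into `3
k`. -/
theorem exp_message_le {M m k K c A : ℝ} (hM : 0 < M) (hm : 0 ≤ m) (hk : 0 < k) (hK : 0 < K)
    (hc : 0 < c) (hA : 0 < A)
    (h1 : Real.log M + 2 * Real.log k ≤ m / 2 * (A / k * Real.log (1 + k / A * c)))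
    (h2 : Real.log M + 3 * A ≤ m / (2 * K) * Real.log (1 + K * c)) (u : ℕ) (huK : u ≤ K) :
    Real.exp (-(m / 2) * Real.log (1 + u * c))
      ≤ (1 / (M * k ^ 2)) ^ u + Real.exp (-(3 * k)) * (1 / M) ^ u := by
  have hu : (0 : ℝ) ≤ u := Nat.cast_nonneg u
  rcases le_or_gt (u * A) k with hle | hgt
  · have h3 := mul_log_one_add_le (t := u * A / k) (x := k / A * c) (by positivity)
      ((div_le_one hk).2 hle) (by positivity)
    rw [show u * A / k * (k / A * c) = u * c by field_simp] at h3
    have h4 : (1 / (M * k ^ 2)) ^ u = Real.exp (-(u * (Real.log M + 2 * Real.log k))) := by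
      rw [← mul_neg, Real.exp_nat_mul, Real.exp_neg, Real.exp_add, Real.exp_log hM]
      congr 1
      rw [show (2 : ℝ) * Real.log k = (2 : ℕ) * Real.log k by norm_num, Real.exp_nat_mul,
        Real.exp_log hk, one_div]
    have h5 : Real.exp (-(m / 2) * Real.log (1 + u * c)) ≤ (1 / (M * k ^ 2)) ^ u := by
      rw [h4, Real.exp_le_exp]
      have h6 := mul_le_mul_of_nonneg_left h1 hu
      have h7 := mul_le_mul_of_nonneg_left h3 (by positivity : 0 ≤ m / 2)
      have h8 : (u : ℝ) * (m / 2 * (A / k * Real.log (1 + k / A * c)))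
        = m / 2 * (u * A / k * Real.log (1 + k / A * c)) := by ring
      linarith
    have : 0 ≤ Real.exp (-(3 * k)) * (1 / M) ^ u := by positivity
    linarith
  · have h3 := mul_log_one_add_le (t := u / K) (x := K * c) (by positivity)
      ((div_le_one hK).2 huK) (by positivity)
    rw [show u / K * (K * c) = u * c by field_simp] at h3
    have h4 : Real.exp (-(3 * k)) * (1 / M) ^ u = Real.exp (-(u * Real.log M + 3 * k)) := by
      rw [show -(u * Real.log M + 3 * k) = -(3 * k) + u * -Real.log M by ring, Real.exp_add,
        Real.exp_nat_mul, Real.exp_neg (Real.log M), Real.exp_log hM, one_div]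
    have h5 : Real.exp (-(m / 2) * Real.log (1 + u * c))
        ≤ Real.exp (-(3 * k)) * (1 / M) ^ u := by
      rw [h4, Real.exp_le_exp]
      have h6 := mul_le_mul_of_nonneg_left h2 hu
      have h7 := mul_le_mul_of_nonneg_left h3 (by positivity : 0 ≤ m / 2)
      have h8 : (u : ℝ) * (m / (2 * K) * Real.log (1 + K * c))
        = m / 2 * (u / K * Real.log (1 + K * c)) := by field_simp
      linarith
    have : 0 ≤ (1 / (M * k ^ 2)) ^ u := by positivity
    linarith

/-! ### Asymptotics of the logarithm -/

section Log

variable {k : ℕ → ℝ}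

theorem tendsto_log_one_add_mul (hk : Tendsto k atTop atTop) {P : ℝ} (hP : 0 < P) :
    Tendsto (fun n => Real.log (1 + k n * P)) atTop atTop :=
  Real.tendsto_log_atTop.comp (tendsto_atTop_add_const_left _ _ (hk.atTop_mul_const hP))

/-- A change of the constant inside the logarithm costs a bounded additive term, negligible since
the logarithm tends to infinity. -/
theorem eventually_log_one_add_mul_ge (hk : Tendsto k atTop atTop) {P c η : ℝ} (hP : 0 < P)
    (hc : 0 < c) (hη : 0 < η) :
    ∀ᶠ n in atTop, (1 - η) * Real.log (1 + k n * P) ≤ Real.log (1 + k n * c) := by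
  set r : ℝ := min (c / P) 1 with hr
  have hr0 : 0 < r := lt_min (by positivity) one_pos
  filter_upwards [(tendsto_log_one_add_mul hk hP).eventually_ge_atTop (-Real.log r / η),
    hk.eventually_ge_atTop 0] with n hn hkn
  have h1 : r * (1 + k n * P) ≤ 1 + k n * c := by
    have h2 : r ≤ 1 := min_le_right _ _
    have h3 : r * P ≤ c := (le_div_iff₀ hP).1 (min_le_left _ _)
    nlinarith
  have h4 := Real.log_le_log (by positivity) h1
  rw [Real.log_mul hr0.ne' (by positivity)] at h4
  rw [div_le_iff₀ hη] at hn
  linarith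

theorem eventually_log_le_two_mul (hk : Tendsto k atTop atTop) {P : ℝ} (hP : 0 < P) :
    ∀ᶠ n in atTop, Real.log (k n) ≤ 2 * Real.log (1 + k n * P) := by
  filter_upwards [(tendsto_log_one_add_mul hk hP).eventually_ge_atTop (-Real.log P),
    hk.eventually_gt_atTop 0] with n hn hkn
  have h4 := Real.log_le_log (by positivity) (by linarith : k n * P ≤ 1 + k n * P)
  rw [Real.log_mul hkn.ne' hP.ne'] at h4
  linarith

theorem eventually_log_one_add_mul_le (hk : Tendsto k atTop atTop) {P r : ℝ} (hP : 0 < P)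
    (hr : 0 < r) : ∀ᶠ n in atTop, Real.log (1 + k n * P) ≤ r * k n := by
  have h1 : Tendsto (fun n => 1 + k n * P) atTop atTop :=
    tendsto_atTop_add_const_left _ _ (hk.atTop_mul_const hP)
  have h2 := (Real.isLittleO_log_id_atTop.comp_tendsto h1).bound
    (by positivity : 0 < r / (2 * P))
  filter_upwards [h2, hk.eventually_ge_atTop (1 / P)] with n hn hkn
  have hkP : 1 ≤ k n * P := (div_le_iff₀ hP).1 hkn
  simp only [Function.comp, id, Real.norm_eq_abs] at hn
  rw [abs_of_pos (by linarith : 0 < 1 + k n * P)] at hn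
  refine (le_abs_self _).trans (hn.trans ?_)
  rw [div_mul_eq_mul_div, div_le_iff₀ (by positivity)]
  nlinarith

end Log

/-! ### The two stages for large blocklength -/

/-- Identification: the conditions on the pairwise error exponents hold for large `n`.  Here
`h` is the entropy `ℓ H₂(α)` of the set of active users, and `m` the signature length. -/
theorem eventually_identification {k m ℓ h δ : ℕ → ℝ} {P c c₀ C e : ℝ}
    (hk : Tendsto k atTop atTop) (hP : 0 < P) (hc : 0 < c) (hc₀ : 0 < c₀) (hC : 0 < C)
    (he₀ : 0 < e) (he₁ : e < 1) (hδ : Tendsto δ atTop (𝓝 0))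
    (hkn : ∀ᶠ n : ℕ in atTop, k n ≤ C * n) (hm : ∀ᶠ n : ℕ in atTop, c₀ * n ≤ m n)
    (hh : ∀ᶠ n in atTop, 0 ≤ h n)
    (hmh : ∀ᶠ n in atTop, (1 + e) * h n ≤ m n / 2 * Real.log (1 + k n * P))
    (hℓ : ∀ᶠ n in atTop, k n * Real.log (ℓ n) ≤ h n + k n * Real.log (k n)) :
    ∃ A : ℝ, 0 < A ∧ ∀ᶠ n in atTop,
      2 * Real.log (ℓ n) ≤ m n / 2 * (A / k n * Real.log (1 + k n / A * c)) ∧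
      (1 + δ n) * h n + 3 * k n ≤ m n / 2 * Real.log (1 + k n / A * c) := by
  -- With `L = log (1 + k P)`, both `h ≤ m L / 2` and `k log k ≤ (4 C / c₀) m L / 2`, so `k log ℓ ≤
  -- (A / 4) m L / 2`. The remaining factor covers the `2` in `2 log ℓ` and the loss in `log (1 + k
  -- c / A) ≥ L / 2`.
  set A : ℝ := 4 * (1 + 4 * C / c₀) with hA
  have hA0 : 0 < A := by positivity
  refine ⟨A, hA0, ?_⟩
  have hη : 0 < e / 8 := by positivity
  filter_upwards [hkn, hm, hh, hmh, hℓ, hk.eventually_gt_atTop 0,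
    eventually_log_le_two_mul hk hP,
    eventually_log_one_add_mul_ge hk hP (by positivity : 0 < c / A) hη,
    (tendsto_log_one_add_mul hk hP).eventually_ge_atTop (48 * C / (e * c₀)),
    (tendsto_log_one_add_mul hk hP).eventually_gt_atTop 0,
    hδ.eventually_le_const (by positivity : 0 < e / 2)]
    with n h1 h2 h3 h4 h5 hk0 h6 h7 h8 hL h9
  rw [show k n * (c / A) = k n / A * c by ring] at h7
  set L := Real.log (1 + k n * P) with hLdef
  set g := Real.log (1 + k n / A * c) with hg
  have hmk : c₀ * k n ≤ C * m n := by nlinarith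
  have hm0 : 0 ≤ m n := by
    by_contra hneg
    nlinarith [mul_pos hc₀ hk0]
  have hg2 : L / 2 ≤ g := by nlinarith
  constructor
  · have h10 : k n * Real.log (ℓ n) ≤ m n * L / 2 * (A / 4) := by
      have h11 : h n ≤ m n * L / 2 := by nlinarith
      have h12 : k n * Real.log (k n) ≤ m n * L / 2 * (4 * C / c₀) := by
        have h13 : k n ≤ C / c₀ * m n := by
          rw [div_mul_eq_mul_div, le_div_iff₀ hc₀]; linarith
        calc k n * Real.log (k n) ≤ k n * (2 * L) := by gcongr
          _ ≤ C / c₀ * m n * (2 * L) := by gcongr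
          _ = m n * L / 2 * (4 * C / c₀) := by ring
      rw [hA]
      linarith
    have h14 : m n / 2 * (A / k n * g) = m n * g * A / 2 / k n := by ring
    rw [h14, le_div_iff₀ hk0]
    have h15 : m n * (L / 2) * A ≤ m n * g * A := by gcongr
    linarith
  -- In units of `m L / 2`: the entropy term takes at most `1 - e / 4`, the term `3 k` at most `e /
  -- 8`, and the right-hand side is at least `1 - e / 8`.
  · have h10 : 3 * k n ≤ e / 8 * (m n * L / 2) := by
      rw [div_le_iff₀ (by positivity)] at h8
      have h11 : 48 * C * k n ≤ C * (e * m n * L) := by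
        calc 48 * C * k n ≤ L * (e * c₀) * k n := by gcongr
          _ = L * e * (c₀ * k n) := by ring
          _ ≤ L * e * (C * m n) := by gcongr
          _ = _ := by ring
      have h12 : 48 * k n ≤ e * m n * L := by
        refine le_of_mul_le_mul_left ?_ hC
        linarith
      linarith
    have h11 : m n / 2 * ((1 - e / 8) * L) ≤ m n / 2 * g := by gcongr
    have h12 : (1 + δ n) * h n ≤ (1 - e / 4) * (m n * L / 2) := by
      have h13 : (1 - e / 4) * ((1 + e) * h n) ≤ (1 - e / 4) * (m n / 2 * L) :=
        mul_le_mul_of_nonneg_left h4 (by linarith)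
      have h14 : 1 + δ n ≤ (1 - e / 4) * (1 + e) := by nlinarith
      have h15 := mul_le_mul_of_nonneg_right h14 h3
      linarith
    linarith

/-- Message decoding: the conditions on the pairwise error exponents hold for large `n`.  Here
`m` is the length of the message-bearing words, and `R` the message capacity. -/
theorem eventually_message {k m M R δ : ℕ → ℝ} {P c c₁ ε : ℝ}
    (hk : Tendsto k atTop atTop) (hP : 0 < P) (hc : 0 < c) (hc₁ : 0 < c₁)
    (hε₀ : 0 < ε) (hε₁ : ε < 1) (hδ : Tendsto δ atTop (𝓝 0)) (hδ₀ : ∀ᶠ n in atTop, 0 ≤ δ n)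
    (hR : ∀ᶠ n in atTop, c₁ * Real.log (1 + k n * P) ≤ R n)
    (hM : ∀ᶠ n in atTop, Real.log (M n) ≤ (1 - ε) * R n + 1)
    (hm : ∀ᶠ n in atTop, (1 - ε / 2) * R n ≤ m n / (2 * k n) * Real.log (1 + k n * P)) :
    ∃ A : ℝ, 0 < A ∧ ∀ᶠ n in atTop,
      Real.log (M n) + 2 * Real.log (k n)
        ≤ m n / 2 * (A / k n * Real.log (1 + k n / A * c)) ∧
      Real.log (M n) + 3 * A ≤ m n / (2 * ((1 + δ n) * k n))
        * Real.log (1 + (1 + δ n) * k n * c) := by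
  -- Chosen so that `A / 4 = 2 + 4 / c₁`: the `2 R` covers `log M`, and `(4 / c₁) R ≥ 4 L` covers `2
  -- log k`.
  set A : ℝ := 8 + 16 / c₁ with hA
  have hA0 : 0 < A := by positivity
  refine ⟨A, hA0, ?_⟩
  have hRlim : Tendsto R atTop atTop :=
    tendsto_atTop_mono' _ hR ((tendsto_log_one_add_mul hk hP).const_mul_atTop hc₁)
  filter_upwards [hδ₀, hR, hM, hm, hk.eventually_gt_atTop 0, eventually_log_le_two_mul hk hP,
    eventually_log_one_add_mul_ge hk hP (by positivity : 0 < c / A) (by norm_num : (0 : ℝ) < 1 / 2),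
    eventually_log_one_add_mul_ge hk hP hc (by positivity : 0 < ε / 8),
    (tendsto_log_one_add_mul hk hP).eventually_gt_atTop 0,
    hδ.eventually_le_const (by positivity : 0 < ε / 8),
    hRlim.eventually_ge_atTop 1, hRlim.eventually_ge_atTop ((1 + 3 * A) / (ε / 4))]
    with n hδn h1 h2 h3 hk0 h4 h5 h6 hL h7 hR1 h8
  rw [show k n * (c / A) = k n / A * c by ring] at h5
  set L := Real.log (1 + k n * P) with hLdef
  have hm0 : 0 ≤ m n := by
    by_contra hneg
    push Not at hneg
    have : m n / (2 * k n) * L ≤ 0 :=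
      mul_nonpos_of_nonpos_of_nonneg (div_nonpos_of_nonpos_of_nonneg hneg.le (by positivity)) hL.le
    nlinarith
  constructor
  · have h10 : A / 2 * (m n / (2 * k n) * L)
        ≤ m n / 2 * (A / k n * Real.log (1 + k n / A * c)) := by
      calc A / 2 * (m n / (2 * k n) * L) = m n / 2 * (A / k n * ((1 - 1 / 2) * L)) := by
            field_simp; ring
        _ ≤ _ := by gcongr
    have h11 : A / 4 * R n ≤ A / 2 * (m n / (2 * k n) * L) := by
      have := mul_le_mul_of_nonneg_left h3 (by positivity : 0 ≤ A / 2)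
      nlinarith [mul_pos hA0 (by linarith : 0 < R n)]
    have h12 : 4 * L ≤ 4 / c₁ * R n := by
      rw [div_mul_eq_mul_div, le_div_iff₀ hc₁]
      linarith
    have h13 : A / 4 * R n = 2 * R n + 4 / c₁ * R n := by rw [hA]; ring
    have : 0 ≤ ε * R n := by positivity
    linarith
  · have h9 : (1 - ε / 8) * L ≤ Real.log (1 + (1 + δ n) * k n * c) := by
      refine h6.trans (Real.log_le_log (by positivity) ?_)
      nlinarith [mul_nonneg hδn (mul_pos hk0 hc).le]
    have h10 : (1 - ε / 8) * (1 - ε / 8) * (m n / (2 * k n) * L)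
        ≤ m n / (2 * ((1 + δ n) * k n)) * Real.log (1 + (1 + δ n) * k n * c) := by
      calc (1 - ε / 8) * (1 - ε / 8) * (m n / (2 * k n) * L)
          = (1 - ε / 8) * (m n / (2 * k n)) * ((1 - ε / 8) * L) := by ring
        _ ≤ 1 / (1 + δ n) * (m n / (2 * k n)) * Real.log (1 + (1 + δ n) * k n * c) := by
            have h11 : 1 - ε / 8 ≤ 1 / (1 + δ n) := by
              rw [le_div_iff₀ (by linarith)]
              nlinarith
            have h12 : 0 ≤ (1 - ε / 8) * L := mul_nonneg (by linarith) hL.le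
            gcongr
        _ = _ := by
            have : 1 + δ n ≠ 0 := by linarith
            field_simp
    have h11 : (1 - ε / 8) * (1 - ε / 8) * ((1 - ε / 2) * R n)
        ≤ (1 - ε / 8) * (1 - ε / 8) * (m n / (2 * k n) * L) :=
      mul_le_mul_of_nonneg_left h3 (mul_self_nonneg _)
    -- The accumulated losses stay below `3 ε / 4`, so `(ε / 4) R` is left over the rate `(1 - ε) R`
    -- to absorb `1 + 3 A`.
    have h12 : 1 - 3 * ε / 4 ≤ (1 - ε / 8) * (1 - ε / 8) * (1 - ε / 2) := by
      nlinarith [mul_pos hε₀ hε₀, mul_pos (mul_pos hε₀ hε₀) (by linarith : 0 < 1 - ε)]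
    have h13 := mul_le_mul_of_nonneg_right h12 (by linarith : 0 ≤ R n)
    rw [div_le_iff₀ (by positivity)] at h8
    linarith

/-! ### Vanishing failure probability -/

/-- Let `x₀` be the limiting fraction of the block spent on signatures: `e` if `θ = 0`, and `(1 + e)
θ` otherwise. The bound on `e` makes `x₀ < 1` and `1 - x₀ > (1 - ε/2) (1 - θ)`. If `θ = 0`, then `e`
eventually exceeds `(1 + e) θ_n`. -/
theorem sigLength_asymptotics {ℓ : ℕ → ℕ} {α : ℕ → ℝ} {P θ e ε : ℝ}
    (hθ : Tendsto (overhead ℓ α P) atTop (𝓝 θ)) (hθ₀ : 0 ≤ θ) (hθ₁ : θ < 1)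
    (he₀ : 0 < e) (he₁ : e < 1) (hε₁ : ε < 1) (he : e < ε / 2 * (1 - θ)) :
    ∃ c₀ : ℝ, 0 < c₀ ∧ ∀ᶠ n : ℕ in atTop, c₀ * n ≤ sigLength ℓ α P θ e n ∧
      (1 + e) * overhead ℓ α P n * n ≤ sigLength ℓ α P θ e n ∧
      (1 - ε / 2) * (1 - overhead ℓ α P n) * n ≤ (n - sigLength ℓ α P θ e n : ℕ) := by
  obtain ⟨x, x₀, hx, hsig, hx₀, hx₁, hxε, hxT⟩ : ∃ (x : ℕ → ℝ) (x₀ : ℝ), Tendsto x atTop (𝓝 x₀) ∧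
      (∀ n : ℕ, sigLength ℓ α P θ e n = min ⌈x n * n⌉₊ n) ∧ 0 < x₀ ∧ x₀ < 1 ∧
      0 < 1 - x₀ - (1 - ε / 2) * (1 - θ) ∧
      ∀ᶠ n in atTop, (1 + e) * overhead ℓ α P n ≤ x n := by
    rcases eq_or_ne θ 0 with rfl | hne
    · refine ⟨fun _ => e, e, tendsto_const_nhds, fun n => by simp [sigLength], he₀, he₁,
        by linarith, ?_⟩
      have h1 : Tendsto (fun n => (1 + e) * overhead ℓ α P n) atTop (𝓝 ((1 + e) * 0)) :=
        hθ.const_mul _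
      exact h1.eventually_le_const (by simpa using he₀)
    · have hpos : 0 < θ := lt_of_le_of_ne hθ₀ hne.symm
      refine ⟨fun n => (1 + e) * overhead ℓ α P n, (1 + e) * θ, hθ.const_mul _,
        fun n => by simp [sigLength, hne], by positivity, ?_, ?_, Eventually.of_forall
        fun _ => le_rfl⟩
      · nlinarith
      · nlinarith
  -- The term `1 / n` pays for rounding the signature length up.
  have hlim : Tendsto (fun n : ℕ => 1 - x n - (1 - ε / 2) * (1 - overhead ℓ α P n) - 1 / (n : ℝ))
      atTop (𝓝 (1 - x₀ - (1 - ε / 2) * (1 - θ) - 0)) :=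
    ((hx.const_sub 1).sub ((hθ.const_sub 1).const_mul _)).sub tendsto_one_div_atTop_nhds_zero_nat
  rw [sub_zero] at hlim
  refine ⟨x₀ / 2, by positivity, ?_⟩
  filter_upwards [hxT, hx.eventually_le_const hx₁, hx.eventually_const_le (half_lt_self hx₀),
    hlim.eventually_const_lt hxε, eventually_ge_atTop 1] with n h1 h2 h3 h4 h5
  have hn : (1 : ℝ) ≤ n := by exact_mod_cast h5
  have hle : x n * n ≤ (sigLength ℓ α P θ e n : ℝ) := by
    rw [hsig, Nat.cast_min]
    exact le_min (Nat.le_ceil _) (by nlinarith)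
  have hge : (sigLength ℓ α P θ e n : ℝ) ≤ x n * n + 1 := by
    rw [hsig, Nat.cast_min]
    exact (min_le_left _ _).trans (Nat.ceil_lt_add_one (by nlinarith)).le
  refine ⟨by nlinarith, by nlinarith, ?_⟩
  rw [Nat.cast_sub (sigLength_le ℓ α P θ e n)]
  have h6 := mul_pos h4 (by linarith : (0 : ℝ) < n)
  have h7 : 1 / (n : ℝ) * n = 1 := by field_simp
  nlinarith

theorem codeSize_pos (v : ℕ → ℝ) (n : ℕ) : 0 < codeSize v n :=
  Nat.ceil_pos.2 (Real.exp_pos _)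

theorem codeSize_le {v : ℕ → ℝ} {n : ℕ} (hv : 0 ≤ v n) :
    (codeSize v n : ℝ) ≤ 2 * Real.exp (v n) := by
  have h1 := (Nat.ceil_lt_add_one (Real.exp_pos (v n)).le).le
  have h2 := Real.one_le_exp hv
  unfold codeSize
  linarith

theorem log_codeSize_le {v : ℕ → ℝ} {n : ℕ} (hv : 0 ≤ v n) :
    Real.log (codeSize v n) ≤ v n + 1 := by
  have h0 : (0 : ℝ) < codeSize v n := by exact_mod_cast codeSize_pos v n
  refine (Real.log_le_log h0 (codeSize_le hv)).trans ?_
  rw [Real.log_mul two_ne_zero (Real.exp_pos _).ne', Real.log_exp]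
  linarith [Real.log_two_lt_d9]

theorem mul_binEntropy_eq_overhead {ℓ : ℕ → ℕ} {α : ℕ → ℝ} {P : ℝ} {n : ℕ} (hn : 0 < n)
    (hL : 0 < Real.log (1 + avgActive ℓ α n * P)) :
    ℓ n * Real.binEntropy (α n)
      = overhead ℓ α P n * n / 2 * Real.log (1 + avgActive ℓ α n * P) := by
  have hn' : (n : ℝ) ≠ 0 := by positivity
  have := hL.ne'
  unfold overhead
  field_simp

/-- Shows that `B(n)` is what the fraction `1 - θ_n` of the block can carry, the entropy of the
active set taking the rest. -/
theorem msgCapacity_eq {ℓ : ℕ → ℕ} {α : ℕ → ℝ} {P : ℝ} {n : ℕ} (hn : 0 < n)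
    (hk : 0 < avgActive ℓ α n) (hL : 0 < Real.log (1 + avgActive ℓ α n * P)) :
    msgCapacity ℓ α P n = (1 - overhead ℓ α P n) * n / (2 * avgActive ℓ α n)
      * Real.log (1 + avgActive ℓ α n * P) := by
  have h1 := mul_binEntropy_eq_overhead hn hL
  have hα : α n ≠ 0 := left_ne_zero_of_mul hk.ne'
  have hℓ : (ℓ n : ℝ) ≠ 0 := right_ne_zero_of_mul hk.ne'
  have h2 : Real.binEntropy (α n) / α n
      = ℓ n * Real.binEntropy (α n) / avgActive ℓ α n := by
    rw [avgActive]
    field_simp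
  rw [msgCapacity, h2, h1]
  field_simp

/-- Since `ℓ = k / α`, `log ℓ = log (1 / α) + log k`, and `k log (1 / α)` is one of the two
nonnegative terms of `ℓ H₂(α)`. -/
theorem mul_log_le_entropy {ℓ : ℕ → ℕ} {α : ℕ → ℝ} {n : ℕ} (hα : α n ≤ 1) (hα₀ : 0 < α n)
    (hℓ : 0 < ℓ n) :
    avgActive ℓ α n * Real.log (ℓ n)
      ≤ ℓ n * Real.binEntropy (α n) + avgActive ℓ α n * Real.log (avgActive ℓ α n) := by
  have hℓ' : (0 : ℝ) < ℓ n := by exact_mod_cast hℓ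
  have h1 : 0 ≤ (1 - α n) * Real.log (1 - α n)⁻¹ := by
    rw [Real.log_inv]
    exact mul_nonneg (by linarith)
      (neg_nonneg.2 (Real.log_nonpos (by linarith) (by linarith)))
  rw [avgActive, Real.log_mul hα₀.ne' hℓ'.ne', Real.binEntropy, Real.log_inv (α n)]
  nlinarith [mul_nonneg hℓ'.le h1]

/-- As `ℓ ≥ 1` eventually, `exp (-k) ≤ ℓ exp (-k) → 0`, which forces `k → ∞` along the full
sequence. -/
theorem tendsto_avgActive {ℓ : ℕ → ℕ} {α : ℕ → ℝ} (hℓ : Tendsto ℓ atTop atTop)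
    (hk_exp : Tendsto (fun n => (ℓ n : ℝ) * Real.exp (-1 * avgActive ℓ α n)) atTop (𝓝 0)) :
    Tendsto (avgActive ℓ α) atTop atTop := by
  have h1 : Tendsto (fun n => Real.exp (-avgActive ℓ α n)) atTop (𝓝 0) := by
    refine squeeze_zero' (Eventually.of_forall fun n => (Real.exp_pos _).le) ?_ hk_exp
    filter_upwards [hℓ.eventually_ge_atTop 1] with n hn
    have : (1 : ℝ) ≤ ℓ n := by exact_mod_cast hn
    rw [neg_one_mul]
    nlinarith [Real.exp_pos (-avgActive ℓ α n)]
  rw [← tendsto_neg_atBot_iff]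
  exact Real.tendsto_exp_comp_nhds_zero.1 h1

theorem tendsto_twoStageFailureProb {ℓ : ℕ → ℕ} {α : ℕ → ℝ} {P θ : ℝ} (hP : 0 < P)
    (hα : ∀ n, α n ∈ Set.Icc (0 : ℝ) 1) (hℓ : Tendsto ℓ atTop atTop)
    (hk_bigO : avgActive ℓ α =O[atTop] fun n : ℕ => (n : ℝ))
    (hk_exp : ∀ δ : ℝ, 0 < δ →
      Tendsto (fun n => (ℓ n : ℝ) * Real.exp (-δ * avgActive ℓ α n)) atTop (𝓝 0))
    (hθ : Tendsto (overhead ℓ α P) atTop (𝓝 θ)) (hθ_lt : θ < 1)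
    {ε : ℝ} (hε₀ : 0 < ε) (hε₁ : ε < 1) {e : ℝ} (he₀ : 0 < e) (he₁ : e < 1) (heP : e < P)
    (heε : e < ε / 2 * (1 - θ)) :
    Tendsto (fun n => twoStageFailureProb (sigLength_le ℓ α P θ e n) (ℓ n)
      (codeSize (fun n => (1 - ε) * msgCapacity ℓ α P n) n) (α n) P (P - e).toNNReal
      (weightBound (avgActive ℓ α n))) atTop (𝓝 0) := by
  set k := avgActive ℓ α with hkdef
  set T := overhead ℓ α P with hTdef
  set R := msgCapacity ℓ α P with hRdef
  set v : ℝ≥0 := (P - e).toNNReal with hv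
  have hvP : (v : ℝ) = P - e := Real.coe_toNNReal _ (by linarith)
  have hv₀ : (0 : ℝ) < v := by rw [hvP]; linarith
  set q := powerExponent P v with hq
  have hq₀ : 0 < q := powerExponent_pos hv₀ (by rw [hvP]; linarith)
  have hk : Tendsto k atTop atTop := tendsto_avgActive hℓ (hk_exp 1 one_pos)
  have hL := tendsto_log_one_add_mul hk hP
  obtain ⟨C, hC, hkC⟩ : ∃ C : ℝ, 0 < C ∧ ∀ᶠ n : ℕ in atTop, k n ≤ C * n := by
    obtain ⟨C, hC, h⟩ := hk_bigO.exists_pos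
    refine ⟨C, hC, h.bound.mono fun n hn => (le_abs_self _).trans ?_⟩
    simpa using hn
  have hα₀ : ∀ᶠ n in atTop, 0 < α n := (hk.eventually_gt_atTop 0).mono fun n hn =>
    lt_of_le_of_ne (hα n).1 (left_ne_zero_of_mul hn.ne').symm
  have hT₀ : ∀ᶠ n in atTop, 0 ≤ T n := by
    filter_upwards [hL.eventually_gt_atTop 0] with n hLn
    have := Real.binEntropy_nonneg (hα n).1 (hα n).2
    exact div_nonneg (by positivity) (mul_nonneg (Nat.cast_nonneg n) hLn.le)
  have hθ₀ : 0 ≤ θ := ge_of_tendsto hθ hT₀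
  obtain ⟨c₀, hc₀, hsig⟩ := sigLength_asymptotics hθ hθ₀ hθ_lt he₀ he₁ hε₁ heε
  have hδ : Tendsto (fun n => k n ^ (-(1 / 3) : ℝ)) atTop (𝓝 0) :=
    (tendsto_rpow_neg_atTop (by norm_num : (0 : ℝ) < 1 / 3)).comp hk
  have hReq : ∀ᶠ n : ℕ in atTop,
      R n = (1 - T n) * n / (2 * k n) * Real.log (1 + k n * P) := by
    filter_upwards [eventually_gt_atTop 0, hk.eventually_gt_atTop 0, hL.eventually_gt_atTop 0]
      with n h1 h2 h3
    exact msgCapacity_eq h1 h2 h3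
  -- Eventually `1 - θ_n ≥ (1 - θ) / 2` and `n / k ≥ 1 / C`. Thus `B(n)` dominates a multiple of
  -- `log (1 + k P)`, and so absorbs `log k` and bounded terms.
  have hR₀ : ∀ᶠ n in atTop, (1 - θ) / (4 * C) * Real.log (1 + k n * P) ≤ R n := by
    filter_upwards [hReq, hkC, hk.eventually_gt_atTop 0, hL.eventually_gt_atTop 0,
      hθ.eventually_le_const (by linarith : θ < (1 + θ) / 2)] with n h1 h2 h3 h4 h5
    rw [h1]
    refine mul_le_mul_of_nonneg_right ?_ h4.le
    rw [div_le_div_iff₀ (by positivity) (by positivity)]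
    nlinarith [mul_le_mul_of_nonneg_left h2 (by linarith : 0 ≤ 1 - θ),
      mul_le_mul_of_nonneg_left (by linarith : (1 - θ) / 2 ≤ 1 - T n)
      (by positivity : 0 ≤ 4 * C * (n : ℝ))]
  have hc₁ : 0 < (1 - θ) / (4 * C) := div_pos (by linarith) (by positivity)
  have hRpos : ∀ᶠ n in atTop, 0 ≤ R n := by
    filter_upwards [hR₀, hL.eventually_gt_atTop 0] with n h1 h2
    exact (mul_pos hc₁ h2).le.trans h1
  set M := codeSize fun n => (1 - ε) * R n with hM
  obtain ⟨A, hA, hid⟩ := eventually_identification (k := k)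
    (m := fun n => (sigLength ℓ α P θ e n : ℝ)) (ℓ := fun n => (ℓ n : ℝ))
    (h := fun n => ℓ n * Real.binEntropy (α n)) (c := v / 4)
    hk hP (by positivity) hc₀ hC he₀ he₁ hδ hkC (hsig.mono fun n hn => hn.1)
    (Eventually.of_forall fun n =>
      mul_nonneg (Nat.cast_nonneg _) (Real.binEntropy_nonneg (hα n).1 (hα n).2))
    (by
      filter_upwards [hsig, eventually_gt_atTop 0, hL.eventually_gt_atTop 0] with n h1 h2 h3
      rw [mul_binEntropy_eq_overhead h2 h3]
      have := mul_le_mul_of_nonneg_right h1.2.1 h3.le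
      linarith)
    (by
      filter_upwards [hα₀, hℓ.eventually_gt_atTop 0] with n h1 h2
      exact mul_log_le_entropy (hα n).2 h1 h2)
  obtain ⟨A', hA', hmsg⟩ := eventually_message (k := k)
    (m := fun n => ((n - sigLength ℓ α P θ e n : ℕ) : ℝ)) (M := fun n => (M n : ℝ)) (R := R)
    (c := v / 2) hk hP (by positivity) hc₁ hε₀ hε₁ hδ
    (by
      filter_upwards [hk.eventually_gt_atTop 0] with n hn
      exact (Real.rpow_pos_of_pos hn _).le)
    hR₀
    (by
      filter_upwards [hRpos] with n hn
      exact log_codeSize_le (mul_nonneg (by linarith) hn))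
    (by
      filter_upwards [hsig, hReq, hk.eventually_gt_atTop 0, hL.eventually_gt_atTop 0]
        with n h1 h2 h3 h4
      rw [h2, ← mul_assoc]
      refine mul_le_mul_of_nonneg_right ?_ h4.le
      rw [← mul_div_assoc]
      refine div_le_div_of_nonneg_right ?_ (by positivity)
      linarith [h1.2.2])
  have hpow : Tendsto (fun n : ℕ => (ℓ n : ℝ) * (M n + 1) * Real.exp (-(n * q)))
      atTop (𝓝 0) := by
    have hlim : Tendsto (fun n : ℕ => 3 * Real.exp (-(q / 2 * n))) atTop (𝓝 0) := by
      have h1 : Tendsto (fun n : ℕ => q / 2 * (n : ℝ)) atTop atTop :=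
        tendsto_natCast_atTop_atTop.const_mul_atTop (by positivity)
      simpa using (Real.tendsto_exp_neg_atTop_nhds_zero.comp h1).const_mul 3
    refine squeeze_zero' (Eventually.of_forall fun n => by positivity) ?_ hlim
    -- With this rate, `ℓ ≤ exp (q k / (4 C)) ≤ exp (q n / 4)`. The number of messages also costs at
    -- most `exp (q n / 4)` up to a constant, so half of the power exponent survives.
    have hs : 0 < q / (4 * C) := by positivity
    filter_upwards [hRpos, hReq, hkC, hk.eventually_gt_atTop 0, hL.eventually_gt_atTop 0, hT₀,
      eventually_log_one_add_mul_le hk hP (by positivity : 0 < q / 2),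
      (hk_exp _ hs).eventually_le_const one_pos] with n h1 h2 h3 h4 h5 h6 h7 h8
    have hℓn : (ℓ n : ℝ) ≤ Real.exp (q / 4 * n) := by
      have h9 : (ℓ n : ℝ) ≤ Real.exp (q / (4 * C) * k n) := by
        rw [neg_mul, Real.exp_neg, ← div_eq_mul_inv, div_le_one (Real.exp_pos _)] at h8
        exact h8
      refine h9.trans (Real.exp_le_exp.2 ?_)
      calc q / (4 * C) * k n ≤ q / (4 * C) * (C * n) := by gcongr
        _ = q / 4 * n := by field_simp
    -- The message length is `o(n)` because `log (1 + k P) = o(k)`.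
    have hRn : R n ≤ q / 4 * n := by
      rw [h2]
      calc (1 - T n) * n / (2 * k n) * Real.log (1 + k n * P)
          ≤ 1 * n / (2 * k n) * (q / 2 * k n) := by
            gcongr
            linarith
        _ = q / 4 * n := by field_simp; ring
    have hMn : (M n : ℝ) + 1 ≤ 3 * Real.exp (q / 4 * n) := by
      have h9 : 0 ≤ (1 - ε) * R n := mul_nonneg (by linarith) h1
      have h10 : (M n : ℝ) ≤ 2 * Real.exp ((1 - ε) * R n) := codeSize_le h9
      have h11 : Real.exp ((1 - ε) * R n) ≤ Real.exp (q / 4 * n) :=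
        Real.exp_le_exp.2 (by nlinarith)
      have h12 := Real.one_le_exp h9
      linarith
    calc (ℓ n : ℝ) * (M n + 1) * Real.exp (-(n * q))
        ≤ Real.exp (q / 4 * n) * (3 * Real.exp (q / 4 * n)) * Real.exp (-(n * q)) := by gcongr
      _ = 3 * (Real.exp (q / 4 * n) * Real.exp (q / 4 * n) * Real.exp (-(n * q))) := by ring
      _ = 3 * Real.exp (-(q / 2 * n)) := by
          rw [← Real.exp_add, ← Real.exp_add]
          congr 2
          ring
  have hbound : ∀ᶠ n : ℕ in atTop,
      twoStageFailureProb (sigLength_le ℓ α P θ e n) (ℓ n) (M n) (α n) P v (weightBound (k n))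
      ≤ Real.exp (-((k n ^ (-(1 / 3) : ℝ)) ^ 2 * k n / 4))
        + (ℓ n * (M n + 1) * Real.exp (-(n * q))
          + ((Real.exp (1 / (ℓ n : ℝ)) - 1) + Real.exp (-k n))
          + ((Real.exp (2 / k n) - 1) + Real.exp (-k n))) := by
    filter_upwards [hid, hmsg, hα₀, hℓ.eventually_gt_atTop 0, hk.eventually_ge_atTop 1]
      with n h1 h2 h3 h4 h5
    have hk0 : 0 < k n := by linarith
    have hδ₀ : 0 ≤ k n ^ (-(1 / 3) : ℝ) := by positivity
    have hδ₁ : k n ^ (-(1 / 3) : ℝ) ≤ 1 := Real.rpow_le_one_of_one_le_of_nonpos h5 (by norm_num)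
    have hMpos : (0 : ℝ) < M n := by exact_mod_cast codeSize_pos _ n
    refine twoStageFailureProb_le (sigLength_le ℓ α P θ e n) h4 (codeSize_pos _ n) h3 (hα n).2
      (by exact_mod_cast hv₀) (by rw [hvP]; linarith) hδ₀ hδ₁ (fun u _ => ?_) (fun u _ hu => ?_)
    · rw [mul_div_assoc]
      exact exp_identification_le (by exact_mod_cast h4) (Nat.cast_nonneg _) hk0 (by positivity)
        hA h1.1 h1.2 u
    · rw [mul_div_assoc]
      exact exp_message_le hMpos (Nat.cast_nonneg _) hk0 (by positivity) (by positivity)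
        hA' h2.1 h2.2 u hu
  refine squeeze_zero' (Eventually.of_forall fun n => Finset.sum_nonneg fun w _ =>
    mul_nonneg (messageTupleProb_nonneg (hα n) w) measureReal_nonneg) hbound ?_
  -- Here `(k ^ (-1/3))² k = k ^ (1/3)`, which tends to infinity.
  have hz1 : Tendsto (fun n => Real.exp (-((k n ^ (-(1 / 3) : ℝ)) ^ 2 * k n / 4)))
      atTop (𝓝 0) := by
    refine Real.tendsto_exp_neg_atTop_nhds_zero.comp ?_
    have h1 : Tendsto (fun n => k n ^ (1 / 3 : ℝ) / 4) atTop atTop :=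
      ((tendsto_rpow_atTop (by norm_num : (0 : ℝ) < 1 / 3)).comp hk).atTop_div_const (by norm_num)
    refine h1.congr' ?_
    filter_upwards [hk.eventually_gt_atTop 0] with n hn
    congr 1
    nth_rw 3 [← Real.rpow_one (k n)]
    rw [← Real.rpow_natCast, ← Real.rpow_mul hn.le, ← Real.rpow_add hn]
    norm_num
  have hz2 : Tendsto (fun n => Real.exp (1 / (ℓ n : ℝ)) - 1) atTop (𝓝 0) := by
    have h1 : Tendsto (fun n => 1 / (ℓ n : ℝ)) atTop (𝓝 0) :=
      tendsto_one_div_atTop_nhds_zero_nat.comp hℓ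
    have h2 := (Real.continuous_exp.tendsto 0).comp h1
    rw [Real.exp_zero] at h2
    simpa using h2.sub_const 1
  have hz3 : Tendsto (fun n => Real.exp (2 / k n) - 1) atTop (𝓝 0) := by
    have h1 : Tendsto (fun n => 2 / k n) atTop (𝓝 0) := hk.const_div_atTop 2
    have h2 := (Real.continuous_exp.tendsto 0).comp h1
    rw [Real.exp_zero] at h2
    simpa using h2.sub_const 1
  have hz4 : Tendsto (fun n => Real.exp (-k n)) atTop (𝓝 0) :=
    Real.tendsto_exp_neg_atTop_nhds_zero.comp hk
  simpa using hz1.add ((hpow.add (hz2.add hz4)).add (hz3.add hz4))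

theorem isAsymptoticallyAchievableBy_twoStage {ℓ : ℕ → ℕ} {α : ℕ → ℝ} {P : ℝ} (hP : 0 ≤ P)
    (hα : ∀ n, α n ∈ Set.Icc (0 : ℝ) 1) (v : ℕ → ℝ) (V : ℕ → ℝ≥0) {n₀ : ℕ → ℕ}
    (h : ∀ n, n₀ n ≤ n) {K : ℕ → ℝ} (hK : ∀ n, 0 ≤ K n)
    (hlim : Tendsto (fun n => twoStageFailureProb (h n) (ℓ n) (codeSize v n) (α n) P (V n) (K n))
      atTop (𝓝 0)) :
    IsAsymptoticallyAchievableBy ℓ α P v fun n C => IsTwoStageCode (h n) (K n) C := by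
  choose C hC hCle using fun n =>
    exists_twoStageCode (h n) (ℓ n) (codeSize_pos v n) (hα n) hP (V n) (hK n)
  refine ⟨C, hC, squeeze_zero' (Eventually.of_forall fun n => Finset.sum_nonneg fun w _ =>
    mul_nonneg (messageTupleProb_nonneg (hα n) w) measureReal_nonneg) ?_ hlim⟩
  filter_upwards [hlim.eventually_lt_const one_pos] with n hn
  exact hCle n hn

theorem weightBound_nonneg {k : ℝ} (hk : 0 ≤ k) : 0 ≤ weightBound k := by
  unfold weightBound
  positivity

end ManyAccess

end

/-! ### Choice of `e₀` and conclusion -/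

open ManyAccess in
theorem theorem3 (ℓ : ℕ → ℕ) (α : ℕ → ℝ) (P a θ : ℝ) (hP : 0 < P)
    (hα : ∀ n, α n ∈ Set.Icc (0 : ℝ) 1)
    (hα_lim : Tendsto α atTop (𝓝 a))
    (hℓ_mono : Monotone ℓ)
    (hℓ_unbounded : ¬ BddAbove (Set.range ℓ))
    (hk_unbounded : ¬ BddAbove (Set.range (avgActive ℓ α)))
    (hk_bigO : avgActive ℓ α =O[atTop] fun n : ℕ => (n : ℝ))
    (hk_exp : ∀ δ : ℝ, 0 < δ →
      Tendsto (fun n => (ℓ n : ℝ) * Real.exp (-δ * avgActive ℓ α n)) atTop (𝓝 0))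
    (hθ : Tendsto (overhead ℓ α P) atTop (𝓝 θ)) (hθ_lt : θ < 1)
    (ε : ℝ) (hε₀ : 0 < ε) (hε₁ : ε < 1) :
    IsAsymptoticallyAchievable ℓ α P (fun n => (1 - ε) * msgCapacity ℓ α P n) ∧
    ∃ e₀ : ℝ, 0 < e₀ ∧ e₀ ≤ min 1 P ∧ ∀ e : ℝ, 0 < e → e < e₀ →
      Tendsto (fun n => twoStageFailureProb (sigLength_le ℓ α P θ e n) (ℓ n)
          (codeSize (fun n => (1 - ε) * msgCapacity ℓ α P n) n) (α n) P (P - e).toNNReal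
          (weightBound (avgActive ℓ α n))) atTop (𝓝 0) ∧
      IsAsymptoticallyAchievableBy ℓ α P (fun n => (1 - ε) * msgCapacity ℓ α P n)
        (fun n C => IsTwoStageCode (sigLength_le ℓ α P θ e n)
          (weightBound (avgActive ℓ α n)) C) := by
  have hℓ : Tendsto ℓ atTop atTop := by
    refine tendsto_atTop_atTop_of_monotone hℓ_mono fun b => ?_
    by_contra hc
    push Not at hc
    exact hℓ_unbounded ⟨b, by rintro _ ⟨n, rfl⟩; exact (hc n).le⟩
  -- Besides `e < min 1 P`, the bound `e < (ε / 2) (1 - θ)` keeps the signature overhead within half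
  -- of the rate slack.
  have hfail : ∀ e : ℝ, 0 < e → e < min (min 1 P) (ε / 2 * (1 - θ)) →
      Tendsto (fun n => twoStageFailureProb (sigLength_le ℓ α P θ e n) (ℓ n)
          (codeSize (fun n => (1 - ε) * msgCapacity ℓ α P n) n) (α n) P (P - e).toNNReal
          (weightBound (avgActive ℓ α n))) atTop (𝓝 0) := fun e he₀ he => by
    rw [lt_min_iff, lt_min_iff] at he
    exact tendsto_twoStageFailureProb hP hα hℓ hk_bigO hk_exp hθ hθ_lt hε₀ hε₁ he₀ he.1.1 he.1.2
      he.2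
  have hcodes : ∀ e : ℝ, 0 < e → e < min (min 1 P) (ε / 2 * (1 - θ)) →
      IsAsymptoticallyAchievableBy ℓ α P (fun n => (1 - ε) * msgCapacity ℓ α P n)
        (fun n C => IsTwoStageCode (sigLength_le ℓ α P θ e n)
          (weightBound (avgActive ℓ α n)) C) := fun e he₀ he =>
    isAsymptoticallyAchievableBy_twoStage hP.le hα _ (fun _ => (P - e).toNNReal)
      (sigLength_le ℓ α P θ e)
      (fun n => weightBound_nonneg (mul_nonneg (hα n).1 (Nat.cast_nonneg _))) (hfail e he₀ he)
  have he₀ : 0 < min (min 1 P) (ε / 2 * (1 - θ)) :=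
    lt_min (lt_min one_pos hP) (mul_pos (by linarith) (by linarith))
  refine ⟨?_, _, he₀, min_le_left _ _, fun e h₀ h₁ => ⟨hfail e h₀ h₁, hcodes e h₀ h₁⟩⟩
  obtain ⟨C, -, hC⟩ := hcodes _ (half_pos he₀) (half_lt_self he₀)
  exact ⟨C, fun _ => trivial, hC⟩
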